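/- **Setting.** Let $f:2^{[n]}\to\mathbb R_{\ge 0}$ be a non-negative (not necessarily monotone) submodular function, i.e. $f(X\cup Y)+f(X\cap Y)\le f(X)+f(Y)$ for all $X,Y\subseteq[n]$, let $\mathcal M\subseteq 2^{[n]}$ be (the family of independent sets of) a matroid of rank $r\ge 1$, and let $\varepsilon\in(0,\tfrac12)$. Write $f(X\,|\,Y)=f(X\cup Y)-f(Y)$. For a finite non-empty $I\subset\mathbb R$ let $\lfloor a\rfloor_I=\max\{i\in I: i\le a\}$ if $a\ge\min I$, and $\lfloor a\rfloor_I=\min I$ otherwise. A *random-order streaming algorithm* makes one pass over the elements of $[n]$ in a uniformly random order $\pi$. Its memory consists of words, each holding an element of $[n]$ or an integer in $\{0,\dots,n\}$. When an element arrives it updates the memory; it can store only elements that are in memory or have just arrived, and it may query $f$ and membership in $\mathcal M$ only on subsets of the stored elements and the arriving element. At the end it outputs a set of stored elements that is in $\mathcal M$. It is an *$\alpha$-approximation* if $\mathbb E_\pi[f(X_{\rm ALG})]\ge\alpha\cdot\max_{X\in\mathcal M}f(X)$. **Algorithm Greedy-Filtering.** (Elements $e$ with $\{e\}\notin\mathcal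 M$ are ignored in all maxima below and in $T$; ties are broken in favour of the earliest arrival.) * Throughout, maintain the set $T$ of the $\lceil \ln(1/\varepsilon)/\varepsilon\rceil$ elements $e$ of highest value $f(\{e\})$ among those that have arrived. * Phase 1: let $V_0$ be the first $\lceil\varepsilon n\rceil$ elements and $w=\frac r\varepsilon\max_{e\in V_0}f(\{e\})$ (with $w=0$ if there is no such $e$). * Phase 2: let $V_1,\dots,V_r$ be the next $r$ consecutive windows of $\lceil\varepsilon n/r\rceil$ elements each. Let $S_0=\emptyset$, $s_1=\arg\max_{e\in V_1}f(\{e\})$, $S_1=\{s_1\}$; for $i=2,\dots,r$ let $s_i$ maximize $f(\{e\}\,|\,S_{i-1})$ over $e\in V_i\cup\{s_1\}$ with $S_{i-1}\cup\{e\}\in\mathcal M$, and $S_i=S_{i-1}\cup\{s_i\}$. (If $V_1$ has no $e$ with $\{e\}\in\mathcal M$, then $s_1$ is a dummy of marginal value $0$ that adds nothing to the sets $S_i$.) * Phase 3: let $I=\{(1+\varepsilon)^i\varepsilon^2w/r^2 : 0\le i\le\lceil2\log_{1+\varepsilon}(r/\varepsilon)\rceil\}$ and $H=\emptyset$. For each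 remaining element $e$ in order of arrival, add $e$ to $H$ if for some $i\in[r]$ we have $S_{i-1}\cup\{e\}\in\mathcal M$ and $\lfloor f(\{e\}\,|\,S_{i-1})\rfloor_I>\lfloor f(\{s_i\}\,|\,S_{i-1})\rfloor_I$; stop adding elements once $|H|>r\ln(r/\varepsilon)\,|I|/\varepsilon$. * Output $X_{\rm ALG}\in\arg\max\{f(X): X\subseteq T\cup S_r\cup H,\ X\in\mathcal M\}$. (If $n$ is too small for all the windows to fit into the stream, the algorithm works with the part of this schedule that fits.) **Theorem.** Greedy-Filtering is a random-order streaming algorithm in the above sense. For every non-negative submodular $f$, every matroid $\mathcal M$ on $[n]$ of rank $r\ge1$ and every $\varepsilon\in(0,\frac12)$ its output is in $\mathcal M$ and it achieves a $(\frac12-\varepsilon')$-approximation, where $\varepsilon'=8\sqrt{2\varepsilon+\frac{2r}{n}}$. It uses $O\!\left(\frac{r\ln(r/\varepsilon)^2}{\varepsilon^2}\right)$ words of memory for every arrival order and at all times, with an absolute constant; in particular, for each fixed $\varepsilon$ it uses $\widetilde O(r)$ memory, i.e. it is a semi-streaming algorithm. -/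

import Mathlib

/-- A real set function on finite sets is submodular (not necessarily monotone). -/
def Submodular {α : Type} [DecidableEq α] (f : Finset α → ℝ) : Prop :=
  ∀ X Y : Finset α, f (X ∪ Y) + f (X ∩ Y) ≤ f X + f Y

/-! ### The random-order streaming model -/

/-- The two oracles of a problem instance: the value oracle of the set function and the membership
oracle of the matroid. -/
structure Oracle (α : Type) where
  value : Finset α → ℝ
  indep : Finset α → Prop

/-- The oracles of a set function `f` and a matroid `M`. -/
def Oracle.of {α : Type} (f : Finset α → ℝ) (M : Matroid α) : Oracle α where
  value := f
  indep X := M.Indep (X : Set α)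

/-- Two pairs of oracles answer alike on all queries that are subsets of `B`. -/
def Oracle.AgreeOn {α : Type} (B : Finset α) (O O' : Oracle α) : Prop :=
  ∀ X ⊆ B, O.value X = O'.value X ∧ (O.indep X ↔ O'.indep X)

/-- A deterministic one-pass algorithm with oracle access. The content of the memory buffer in a
given state is the list `words`; each word holds an element of the ground set or a number. -/
structure OnePassAlgorithm (α : Type) where
  State : Type
  words : State → List (α ⊕ ℕ)
  init : State
  step : Oracle α → State → α → State
  output : Oracle α → State → Finset α

namespace OnePassAlgorithm

variable {α : Type} [DecidableEq α]

/-- The elements stored in memory. -/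
def stored (A : OnePassAlgorithm α) (σ : A.State) : Finset α :=
  ((A.words σ).filterMap Sum.getLeft?).toFinset

/-- The state after processing a list of elements, one by one. -/
def run (A : OnePassAlgorithm α) (O : Oracle α) (l : List α) : A.State :=
  l.foldl (A.step O) A.init

/-- The stream `π(1), …, π(n)`. -/
def stream {n : ℕ} (π : Equiv.Perm (Fin n)) : List (Fin n) := List.ofFn π

/-- The set returned at the end of the stream `π`. -/
def result {n : ℕ} (A : OnePassAlgorithm (Fin n)) (O : Oracle (Fin n)) (π : Equiv.Perm (Fin n)) :
    Finset (Fin n) :=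
  A.output O (A.run O (stream π))

/-- The expected value of the returned set, for a uniformly random arrival order. -/
noncomputable def expectedValue {n : ℕ} (A : OnePassAlgorithm (Fin n)) (O : Oracle (Fin n)) : ℝ :=
  (∑ π : Equiv.Perm (Fin n), O.value (A.result O π)) / (Fintype.card (Equiv.Perm (Fin n)) : ℝ)

/-- The largest number of memory words in use, over all arrival orders and all times. -/
def memoryUsed {n : ℕ} (A : OnePassAlgorithm (Fin n)) (O : Oracle (Fin n)) : ℕ :=
  (Finset.univ : Finset (Equiv.Perm (Fin n))).sup fun π =>
    (Finset.range (n + 1)).sup fun t => (A.words (A.run O ((stream π).take t))).length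

/-- The rules of the streaming model on the ground set `[n]`. -/
structure IsStreaming {n : ℕ} (A : OnePassAlgorithm (Fin n)) : Prop where
  /-- The buffer is all that the algorithm remembers. -/
  words_injective : Function.Injective A.words
  /-- No element is stored at the start. -/
  stored_init : A.stored A.init = ∅
  /-- Only elements already in the buffer and the arriving element can be stored. -/
  stored_step : ∀ O σ e, A.stored (A.step O σ e) ⊆ insert e (A.stored σ)
  /-- On arrival of `e`, only subsets of the stored elements and `e` are queried. -/
  step_local : ∀ O O' σ e, Oracle.AgreeOn (insert e (A.stored σ)) O O' →
    A.step O σ e = A.step O' σ e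
  /-- The returned set consists of stored elements. -/
  output_stored : ∀ O σ, A.output O σ ⊆ A.stored σ
  /-- To find the returned set, only subsets of the stored elements are queried. -/
  output_local : ∀ O O' σ, Oracle.AgreeOn (A.stored σ) O O' → A.output O σ = A.output O' σ
  /-- A word that holds a number holds one of `0, …, n`, as many bits as the name of an element. -/
  word_size : ∀ O (π : Equiv.Perm (Fin n)) (t k : ℕ),
    Sum.inr k ∈ A.words (A.run O ((stream π).take t)) → k ≤ n

end OnePassAlgorithm

/-! ### The algorithm Greedy-Filtering -/

namespace GreedyFiltering

/-- The rounding operator: the largest member of `I` below `a` (weakly), or the smallest member of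
`I` if there is none. -/
noncomputable def roundDown (I : Finset ℝ) (a : ℝ) : ℝ :=
  if h : (I.filter (· ≤ a)).Nonempty then (I.filter (· ≤ a)).max' h
  else if h' : I.Nonempty then I.min' h' else 0

/-- The memory content. A selector is an element of the ground set or `none`; `none` is the dummy
selector, used only if the first window offers no feasible element. -/
structure State (α : Type) where
  /-- number of elements that have arrived -/
  clock : ℕ
  /-- the set `T`, sorted by decreasing singleton value -/
  top : List α
  /-- the best singleton seen in the first phase -/
  best : Option α
  /-- the selectors `s₁, s₂, …` chosen so far -/
  sel : List (Option α)
  /-- the best candidate so far for the selector of the current window -/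
  cand : Option α
  /-- the set `H` -/
  filt : List α

/-- The memory word of an element or of the dummy. -/
def word {α : Type} : Option α → α ⊕ ℕ
  | some a => Sum.inl a
  | none => Sum.inr 0

/-- The memory words of a state: the counter, the lengths of the three lists, the lists, and the two
single cells. -/
def State.words {α : Type} (σ : State α) : List (α ⊕ ℕ) :=
  [Sum.inr σ.clock, Sum.inr σ.top.length, Sum.inr σ.sel.length, Sum.inr σ.filt.length]
    ++ σ.top.map Sum.inl ++ σ.sel.map word ++ σ.filt.map Sum.inl ++ [word σ.best, word σ.cand]

section
variable {α : Type} [DecidableEq α]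

/-- The set of elements in a list of selectors: `S_i` is `selSet (s₁, …, s_i)`. -/
def selSet (l : List (Option α)) : Finset α := l.reduceOption.toFinset

/-- The marginal value `f({s} | S)`, which is zero for the dummy. -/
def gain (O : Oracle α) (S : Finset α) (s : Option α) : ℝ :=
  O.value (S ∪ s.toFinset) - O.value S

/-- The capacity `⌈ln(1/ε)/ε⌉` of `T`. -/
noncomputable def capacity (ε : ℝ) : ℕ := ⌈Real.log (1 / ε) / ε⌉₊

/-- `w`, which is `r/ε` times the best singleton value of the first phase. -/
noncomputable def bound (r : ℕ) (ε : ℝ) (O : Oracle α) (best : Option α) : ℝ :=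
  best.elim 0 (fun e => O.value {e}) * ((r : ℝ) / ε)

/-- The set `I` of rounded values `(1+ε)^i · ε² w / r²`, `0 ≤ i ≤ ⌈2 log_{1+ε}(r/ε)⌉`. -/
noncomputable def levels (r : ℕ) (ε w : ℝ) : Finset ℝ :=
  (Finset.range (⌈2 * Real.logb (1 + ε) ((r : ℝ) / ε)⌉₊ + 1)).image
    fun i : ℕ => (1 + ε) ^ i * (ε ^ 2 * w / (r : ℝ) ^ 2)

open Classical in
/-- Maintenance of `T`: insert the new element (loops are ignored) after all elements of at least
the same singleton value, and keep the first `capacity ε` elements of the list. -/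
noncomputable def updateTop (ε : ℝ) (O : Oracle α) (top : List α) (e : α) : List α :=
  if O.indep {e} then
    (top.orderedInsert (fun x y => O.value {y} < O.value {x}) e).take (capacity ε)
  else top

open Classical in
/-- First phase: keep the best singleton (loops are ignored). -/
noncomputable def updateBest (O : Oracle α) (best : Option α) (e : α) : Option α :=
  if O.indep {e} ∧ ∀ x ∈ best, O.value {x} < O.value {e} then some e else best

open Classical in
/-- Second phase: keep the best candidate for the current window. In the first window the candidate
starts as `none` and any feasible element replaces it; in later windows it starts as `s₁`. -/
noncomputable def updateCand (O : Oracle α) (sel : List (Option α)) (cand : Option α) (e : α) :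
    Option α :=
  if O.indep (insert e (selSet sel)) ∧
      ((sel = [] ∧ cand = none) ∨ gain O (selSet sel) cand < gain O (selSet sel) (some e))
  then some e else cand

/-- The filter of the third phase: for some `i`, `S_{i-1} ∪ {e}` is independent and `e` has a larger
rounded marginal value than `s_i` with respect to `S_{i-1}`. -/
def Passes (O : Oracle α) (I : Finset ℝ) (sel : List (Option α)) (e : α) : Prop :=
  ∃ (i : ℕ) (s : Option α), sel[i]? = some s ∧
    O.indep (insert e (selSet (sel.take i))) ∧
    roundDown I (gain O (selSet (sel.take i)) s) <
      roundDown I (gain O (selSet (sel.take i)) (some e))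

open Classical in
/-- Third phase: add `e` to `H` if it passes the filter, unless `H` has outgrown the limit
`r ln(r/ε) |I| / ε`, after which `H` never changes. -/
noncomputable def updateFilt (r : ℕ) (ε : ℝ) (O : Oracle α) (σ : State α) (e : α) : List α :=
  let I := levels r ε (bound r ε O σ.best)
  if (σ.filt.length : ℝ) ≤ (r : ℝ) * Real.log ((r : ℝ) / ε) * (I.card : ℝ) / ε ∧
      Passes O I σ.sel e
  then σ.filt ++ [e] else σ.filt

/-- Processing of one arriving element. The first phase takes `⌈εn⌉` elements, the second phase
consists of `r` windows of `⌈εn/r⌉` elements, the third phase takes the rest of the stream. -/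
noncomputable def step (n r : ℕ) (ε : ℝ) (O : Oracle α) (σ : State α) (e : α) : State α :=
  let a := ⌈ε * (n : ℝ)⌉₊
  let b := ⌈ε * (n : ℝ) / (r : ℝ)⌉₊
  let σ' : State α := { σ with clock := σ.clock + 1, top := updateTop ε O σ.top e }
  if σ.clock < a then
    { σ' with best := updateBest O σ.best e }
  else if σ.clock < a + r * b then
    let c := updateCand O σ.sel σ.cand e
    if (σ.clock + 1 - a) % b = 0 then
      -- the window ends: its candidate becomes a selector, and `s₁` is the next candidate
      { σ' with sel := σ.sel ++ [c], cand := (σ.sel ++ [c]).head?.join }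
    else
      { σ' with cand := c }
  else
    { σ' with filt := updateFilt r ε O σ e }

open Classical in
/-- A most valuable independent subset of `B`. -/
noncomputable def bestSubset (O : Oracle α) (B : Finset α) : Finset α :=
  if h : ∃ X ⊆ B, O.indep X ∧ ∀ Y ⊆ B, O.indep Y → O.value Y ≤ O.value X then h.choose else ∅

/-- The returned set: a most valuable independent subset of `T ∪ S_r ∪ H`. -/
noncomputable def output (O : Oracle α) (σ : State α) : Finset α :=
  bestSubset O (σ.top.toFinset ∪ selSet σ.sel ∪ σ.filt.toFinset)

end

end GreedyFiltering

/-- The algorithm Greedy-Filtering for `n` elements, rank `r` and parameter `ε`. -/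
noncomputable def greedyFiltering (n r : ℕ) (ε : ℝ) : OnePassAlgorithm (Fin n) where
  State := GreedyFiltering.State (Fin n)
  words := GreedyFiltering.State.words
  init := ⟨0, [], none, [], none, []⟩
  step := GreedyFiltering.step n r ε
  output := GreedyFiltering.output

/-- A problem instance: `f` is a non-negative submodular function on the subsets of `[n]`, and `M`
is a matroid with ground set `[n]` and rank `r ≥ 1`. -/
structure IsInstance (n r : ℕ) (f : Finset (Fin n) → ℝ) (M : Matroid (Fin n)) : Prop where
  nonneg : ∀ X, 0 ≤ f X
  submodular : Submodular f
  ground : M.E = Set.univ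
  rank : M.eRank = (r : ℕ∞)
  rank_pos : 1 ≤ r

/-! Let O' be the part of an optimum `Opt` that arrives after the two sample phases, and S_r the
greedy chain of selectors. The proof bounds f(O' ∪ S_r) from below by `f Opt` and from above by
twice the value of the output.

From below: O' ∪ S_r can differ from `Opt` at an element only if that element arrives among the q
sampled positions, which has probability q/n. For a non-negative submodular function this gives E
f(O' ∪ S_r) ≥ (1 - 2q/n) f(Opt) without monotonicity (`Submodular.sampling_near`).

From above: split O' = P ∪ L, where P is caught by T ∪ H and L is not. Walking along the chain and
keeping the selectors that stay independent together with P gives A ⊆ S_r with P ∪ A independent,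
and Hall's theorem matches L injectively to kept steps at which the matched element was feasible
(`exists_matching`). An element of L failed the filter, and its absence from T keeps its value
within the range of the rounding, so the matched selector nearly dominates it
(`le_of_roundDown_le`). Hence L adds at most about (1 + ε) f(A) to P ∪ S_r. Since f(P ∪ S_r) ≤ f(P ∪
A) + f(S_r) - f(A), the terms f(A) cancel up to an error, and f(O' ∪ S_r) ≤ f(P ∪ A) + f(S_r) + 3ε
f(Opt) (`exists_hybrid`, `value_le_of_lucky`). The output competes with both P ∪ A and S_r.

The upper bound requires that T catches everything above the best sampled singleton and that H never
reaches its limit. A window of b random positions misses the K best candidates, fixed beforehand,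
with probability at most exp(-Kb/n) (`card_window_bad_le`); with the chosen capacities the total
failure probability is at most 2ε. The filter stays small because each rounding level admits only
elements that beat one particular selector (`card_passing_le`). -/

set_option linter.unusedSectionVars false

/-! ### The rules of the streaming model -/

namespace GreedyFiltering

section
variable {α : Type}

theorem word_injective : Function.Injective (word : Option α → α ⊕ ℕ) := by
  intro x y h
  cases x <;> cases y <;> simp_all [word]

/-- The stored lengths make the concatenation of the three lists uniquely decodable. -/
theorem State.words_injective : Function.Injective (State.words : State α → List (α ⊕ ℕ)) := by
  rintro ⟨c, t, b, s, d, h⟩ ⟨c', t', b', s', d', h'⟩ H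
  simp only [State.words, List.cons_append, List.nil_append, List.cons.injEq, Sum.inr.injEq,
    List.append_assoc] at H
  obtain ⟨h1, h2, h3, h4, H⟩ := H
  obtain ⟨ht, H⟩ := List.append_inj H (by simp [h2])
  obtain ⟨hs, H⟩ := List.append_inj H (by simp [h3])
  obtain ⟨hh, H⟩ := List.append_inj H (by simp [h4])
  simp only [List.cons.injEq, and_true] at H
  have e1 := List.map_injective_iff.2 Sum.inl_injective ht
  have e2 := List.map_injective_iff.2 word_injective hs
  have e3 := List.map_injective_iff.2 Sum.inl_injective hh
  have e4 := word_injective H.1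
  have e5 := word_injective H.2
  subst_vars
  rfl

theorem getLeft?_word (x : Option α) : (word x).getLeft? = x := by
  cases x <;> rfl

variable [DecidableEq α]

theorem mem_selSet {l : List (Option α)} {x : α} : x ∈ selSet l ↔ some x ∈ l := by
  simp [selSet, List.reduceOption_mem_iff]

@[simp] theorem selSet_nil : selSet ([] : List (Option α)) = ∅ := rfl

theorem selSet_append_singleton (l : List (Option α)) (s : Option α) :
    selSet (l ++ [s]) = selSet l ∪ s.toFinset := by
  ext x
  simp [mem_selSet, eq_comm]

theorem selSet_mono {l l' : List (Option α)} (h : l ⊆ l') : selSet l ⊆ selSet l' := by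
  intro x hx
  rw [mem_selSet] at hx ⊢
  exact h hx

/-- The elements stored in a state. -/
theorem mem_stored_iff {n r : ℕ} {ε : ℝ} {σ : State (Fin n)} {x : Fin n} :
    x ∈ (greedyFiltering n r ε).stored σ ↔
      x ∈ σ.top ∨ x ∈ σ.filt ∨ some x ∈ σ.sel ∨ σ.best = some x ∨ σ.cand = some x := by
  have hw : ∀ y : Option (Fin n), (word y).getLeft? = some x ↔ y = some x := by
    intro y
    rw [getLeft?_word]
  change x ∈ ((State.words σ).filterMap Sum.getLeft?).toFinset ↔ _
  simp only [State.words, List.mem_toFinset, List.mem_filterMap, List.mem_append, List.mem_map,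
    List.mem_cons, List.not_mem_nil, or_false]
  constructor
  · rintro ⟨w, h, hx⟩
    rcases h with (((h | ⟨y, hy, rfl⟩) | ⟨y, hy, rfl⟩) | ⟨y, hy, rfl⟩) | (rfl | rfl)
    · rcases h with rfl | rfl | rfl | rfl <;> simp at hx
    · simp at hx; subst hx; tauto
    · rw [hw] at hx; subst hx; tauto
    · simp at hx; subst hx; tauto
    · rw [hw] at hx; tauto
    · rw [hw] at hx; tauto
  · rintro (h | h | h | h | h)
    · exact ⟨Sum.inl x, Or.inl (Or.inl (Or.inl (Or.inr ⟨x, h, rfl⟩))), rfl⟩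
    · exact ⟨Sum.inl x, Or.inl (Or.inr ⟨x, h, rfl⟩), rfl⟩
    · exact ⟨word (some x), Or.inl (Or.inl (Or.inr ⟨_, h, rfl⟩)), rfl⟩
    · exact ⟨word σ.best, Or.inr (Or.inl rfl), (hw _).2 h⟩
    · exact ⟨word σ.cand, Or.inr (Or.inr rfl), (hw _).2 h⟩

theorem updateTop_subset {ε : ℝ} {O : Oracle α} {top : List α} {e x : α}
    (h : x ∈ updateTop ε O top e) : x = e ∨ x ∈ top := by
  unfold updateTop at h
  split_ifs at h
  · simpa using List.mem_of_mem_take h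
  · exact Or.inr h

theorem updateBest_eq_or (O : Oracle α) (best : Option α) (e : α) :
    updateBest O best e = some e ∨ updateBest O best e = best := by
  unfold updateBest
  split_ifs <;> simp

theorem updateCand_eq_or (O : Oracle α) (sel : List (Option α)) (cand : Option α) (e : α) :
    updateCand O sel cand e = some e ∨ updateCand O sel cand e = cand := by
  unfold updateCand
  split_ifs <;> simp

theorem updateFilt_eq_or (r : ℕ) (ε : ℝ) (O : Oracle α) (σ : State α) (e : α) :
    updateFilt r ε O σ e = σ.filt ++ [e] ∨ updateFilt r ε O σ e = σ.filt := by
  unfold updateFilt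
  simp only
  split_ifs <;> simp

theorem head?_join_mem {l : List (Option α)} {x : α} (h : l.head?.join = some x) :
    some x ∈ l := by
  cases l with
  | nil => simp at h
  | cons y l => simp at h; simp [h]

theorem stored_step (n r : ℕ) (ε : ℝ) (O : Oracle (Fin n)) (σ : State (Fin n)) (e : Fin n) :
    (greedyFiltering n r ε).stored (step n r ε O σ e) ⊆
      insert e ((greedyFiltering n r ε).stored σ) := by
  intro x hx
  rw [mem_stored_iff] at hx
  rw [Finset.mem_insert, mem_stored_iff]
  have ht : x ∈ updateTop ε O σ.top e → x = e ∨ x ∈ σ.top := updateTop_subset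
  have hb := updateBest_eq_or O σ.best e
  have hc := updateCand_eq_or O σ.sel σ.cand e
  have hf := updateFilt_eq_or r ε O σ e
  have hj : (σ.sel ++ [updateCand O σ.sel σ.cand e]).head?.join = some x →
      some x ∈ σ.sel ++ [updateCand O σ.sel σ.cand e] := head?_join_mem
  unfold step at hx
  simp only at hx
  split_ifs at hx
  · simp only at hx
    rcases hb with hb | hb <;> rw [hb] at hx <;> grind
  · simp only at hx
    rcases hc with hc | hc <;> rw [hc] at hx hj <;> grind
  · simp only at hx
    rcases hc with hc | hc <;> rw [hc] at hx <;> grind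
  · simp only at hx
    rcases hf with hf | hf <;> rw [hf] at hx <;> grind

/-! ### Locality of the oracle queries. -/

theorem gain_congr {B : Finset α} {O O' : Oracle α} (h : Oracle.AgreeOn B O O') {S : Finset α}
    {s : Option α} (hS : S ⊆ B) (hs : ∀ x ∈ s, x ∈ B) : gain O S s = gain O' S s := by
  unfold gain
  rw [(h S hS).1, (h (S ∪ s.toFinset) _).1]
  apply Finset.union_subset hS
  intro x hx
  exact hs x (by simpa using hx)

theorem indep_congr {B : Finset α} {O O' : Oracle α} (h : Oracle.AgreeOn B O O') {S : Finset α}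
    (hS : S ⊆ B) : O.indep S = O'.indep S := propext (h S hS).2

theorem orderedInsert_congr {R R' : α → α → Prop} [DecidableRel R] [DecidableRel R'] {e : α}
    {l : List α} (h : ∀ x ∈ l, (R e x ↔ R' e x)) :
    l.orderedInsert R e = l.orderedInsert R' e := by
  induction l with
  | nil => rfl
  | cons y l ih =>
    simp only [List.orderedInsert]
    rw [ih fun x hx => h x (by simp [hx])]
    simp only [h y (by simp)]

theorem updateTop_congr {B : Finset α} {O O' : Oracle α} (h : Oracle.AgreeOn B O O') {ε : ℝ}
    {top : List α} {e : α} (he : e ∈ B) (ht : ∀ x ∈ top, x ∈ B) :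
    updateTop ε O top e = updateTop ε O' top e := by
  unfold updateTop
  rw [indep_congr h (by simpa using he)]
  congr 2
  apply orderedInsert_congr
  intro x hx
  rw [(h {e} (by simpa using he)).1, (h {x} (by simpa using ht x hx)).1]

theorem updateBest_congr {B : Finset α} {O O' : Oracle α} (h : Oracle.AgreeOn B O O')
    {best : Option α} {e : α} (he : e ∈ B) (hb : ∀ x ∈ best, x ∈ B) :
    updateBest O best e = updateBest O' best e := by
  have key : (O.indep {e} ∧ ∀ x ∈ best, O.value {x} < O.value {e}) ↔
      (O'.indep {e} ∧ ∀ x ∈ best, O'.value {x} < O'.value {e}) := by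
    rw [indep_congr h (by simpa using he), (h {e} (by simpa using he)).1]
    refine and_congr_right fun _ => forall₂_congr fun x hx => ?_
    rw [(h {x} (by simpa using hb x hx)).1]
  unfold updateBest
  by_cases hk : O.indep {e} ∧ ∀ x ∈ best, O.value {x} < O.value {e}
  · rw [if_pos hk, if_pos (key.1 hk)]
  · rw [if_neg hk, if_neg (mt key.2 hk)]

theorem updateCand_congr {B : Finset α} {O O' : Oracle α} (h : Oracle.AgreeOn B O O')
    {sel : List (Option α)} {cand : Option α} {e : α} (he : e ∈ B) (hs : selSet sel ⊆ B)
    (hc : ∀ x ∈ cand, x ∈ B) :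
    updateCand O sel cand e = updateCand O' sel cand e := by
  unfold updateCand
  rw [indep_congr h (Finset.insert_subset he hs), gain_congr h hs hc,
    gain_congr h hs (by simpa using he)]

theorem passes_congr {B : Finset α} {O O' : Oracle α} (h : Oracle.AgreeOn B O O')
    {I : Finset ℝ} {sel : List (Option α)} {e : α} (he : e ∈ B) (hs : selSet sel ⊆ B) :
    Passes O I sel e = Passes O' I sel e := by
  unfold Passes
  refine propext (exists_congr fun i => exists_congr fun s => and_congr_right fun hi => ?_)
  have h1 : selSet (sel.take i) ⊆ B := (selSet_mono (List.take_subset i sel)).trans hs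
  have h2 : ∀ x ∈ s, x ∈ B := by
    intro x hx
    apply hs
    rw [mem_selSet]
    have := List.mem_of_getElem? hi
    rwa [Option.mem_def.1 hx] at this
  rw [indep_congr h (Finset.insert_subset he h1), gain_congr h h1 h2,
    gain_congr h h1 (by simpa using he)]

theorem bound_congr {B : Finset α} {O O' : Oracle α} (h : Oracle.AgreeOn B O O') {r : ℕ} {ε : ℝ}
    {best : Option α} (hb : ∀ x ∈ best, x ∈ B) : bound r ε O best = bound r ε O' best := by
  unfold bound
  cases best with
  | none => rfl
  | some x =>
    simp only [Option.elim]
    rw [(h {x} (by simpa using hb x rfl)).1]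

theorem updateFilt_congr {B : Finset α} {O O' : Oracle α} (h : Oracle.AgreeOn B O O') {r : ℕ}
    {ε : ℝ} {σ : State α} {e : α} (he : e ∈ B) (hs : selSet σ.sel ⊆ B)
    (hb : ∀ x ∈ σ.best, x ∈ B) : updateFilt r ε O σ e = updateFilt r ε O' σ e := by
  have key := passes_congr h (I := levels r ε (bound r ε O' σ.best)) he hs
  unfold updateFilt
  rw [bound_congr h hb]
  simp only
  split_ifs with h1 h2 h2
  · rfl
  · rw [key] at h1
    exact absurd h1 h2
  · rw [key] at h1
    exact absurd h2 h1
  · rfl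

/-- The maximizer is picked by choice, so equality of the maximal values is not enough: the two
defining predicates must be equal, and then choice returns the same set. -/
theorem bestSubset_congr {B : Finset α} {O O' : Oracle α} (h : Oracle.AgreeOn B O O')
    {D : Finset α} (hD : D ⊆ B) : bestSubset O D = bestSubset O' D := by
  have key : (fun X : Finset α => X ⊆ D ∧ O.indep X ∧ ∀ Y ⊆ D, O.indep Y → O.value Y ≤ O.value X) =
      fun X => X ⊆ D ∧ O'.indep X ∧ ∀ Y ⊆ D, O'.indep Y → O'.value Y ≤ O'.value X := by
    funext X
    refine propext (and_congr_right fun hX => ?_)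
    rw [indep_congr h (hX.trans hD), (h X (hX.trans hD)).1]
    refine and_congr_right fun _ => forall₂_congr fun Y hY => ?_
    rw [indep_congr h (hY.trans hD), (h Y (hY.trans hD)).1]
  have aux : ∀ P Q : Finset α → Prop, P = Q → ∀ (d : Decidable (∃ X, P X))
      (d' : Decidable (∃ X, Q X)),
      (@dite _ (∃ X, P X) d (fun h => h.choose) fun _ => ∅) =
        @dite _ (∃ X, Q X) d' (fun h => h.choose) fun _ => ∅ := by
    rintro P Q rfl d d'
    congr 1
  exact aux _ _ key _ _

theorem step_local (n r : ℕ) (ε : ℝ) (O O' : Oracle (Fin n)) (σ : State (Fin n)) (e : Fin n)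
    (h : Oracle.AgreeOn (insert e ((greedyFiltering n r ε).stored σ)) O O') :
    step n r ε O σ e = step n r ε O' σ e := by
  have he : e ∈ insert e ((greedyFiltering n r ε).stored σ) := Finset.mem_insert_self _ _
  have mem : ∀ {x}, x ∈ (greedyFiltering n r ε).stored σ →
      x ∈ insert e ((greedyFiltering n r ε).stored σ) := fun hx => Finset.mem_insert_of_mem hx
  have hs : selSet σ.sel ⊆ insert e ((greedyFiltering n r ε).stored σ) := by
    intro x hx
    rw [mem_selSet] at hx
    exact mem (mem_stored_iff.2 (by tauto))
  have hb : ∀ x ∈ σ.best, x ∈ insert e ((greedyFiltering n r ε).stored σ) := by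
    intro x hx
    rw [Option.mem_def] at hx
    exact mem (mem_stored_iff.2 (by tauto))
  have hc : ∀ x ∈ σ.cand, x ∈ insert e ((greedyFiltering n r ε).stored σ) := by
    intro x hx
    rw [Option.mem_def] at hx
    exact mem (mem_stored_iff.2 (by tauto))
  have ht : ∀ x ∈ σ.top, x ∈ insert e ((greedyFiltering n r ε).stored σ) :=
    fun x hx => mem (mem_stored_iff.2 (by tauto))
  unfold step
  rw [updateTop_congr h he ht, updateBest_congr h he hb, updateCand_congr h he hs hc,
    updateFilt_congr h he hs hb]

theorem output_subset (O : Oracle α) (σ : State α) :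
    output O σ ⊆ σ.top.toFinset ∪ selSet σ.sel ∪ σ.filt.toFinset := by
  unfold output bestSubset
  split_ifs with h
  · exact h.choose_spec.1
  · simp

theorem union_subset_stored {n r : ℕ} {ε : ℝ} (σ : State (Fin n)) :
    σ.top.toFinset ∪ selSet σ.sel ∪ σ.filt.toFinset ⊆ (greedyFiltering n r ε).stored σ := by
  intro x hx
  simp only [Finset.mem_union, List.mem_toFinset, mem_selSet] at hx
  rw [mem_stored_iff]
  tauto

/-! ### Counters and lengths along a run. -/

theorem length_updateTop_le (ε : ℝ) (O : Oracle α) (top : List α) (e : α) :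
    (updateTop ε O top e).length ≤ top.length + 1 := by
  unfold updateTop
  split_ifs
  · exact (List.length_take_le' _ _).trans (by simp [List.orderedInsert_length])
  · simp

theorem length_updateFilt_le (r : ℕ) (ε : ℝ) (O : Oracle α) (σ : State α) (e : α) :
    (updateFilt r ε O σ e).length ≤ σ.filt.length + 1 := by
  rcases updateFilt_eq_or r ε O σ e with h | h <;> simp [h]

theorem clock_step (n r : ℕ) (ε : ℝ) (O : Oracle α) (σ : State α) (e : α) :
    (step n r ε O σ e).clock = σ.clock + 1 := by
  unfold step
  simp only
  split_ifs <;> rfl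

theorem top_step (n r : ℕ) (ε : ℝ) (O : Oracle α) (σ : State α) (e : α) :
    (step n r ε O σ e).top = updateTop ε O σ.top e := by
  unfold step
  simp only
  split_ifs <;> rfl

theorem length_sel_step_le (n r : ℕ) (ε : ℝ) (O : Oracle α) (σ : State α) (e : α) :
    (step n r ε O σ e).sel.length ≤ σ.sel.length + 1 := by
  unfold step
  simp only
  split_ifs <;> simp

theorem length_filt_step_le (n r : ℕ) (ε : ℝ) (O : Oracle α) (σ : State α) (e : α) :
    (step n r ε O σ e).filt.length ≤ σ.filt.length + 1 := by
  have := length_updateFilt_le r ε O σ e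
  unfold step
  simp only
  split_ifs <;> simp [this]

/-- The state after processing a list of elements. -/
noncomputable def runState (n r : ℕ) (ε : ℝ) (O : Oracle α) (l : List α) : State α :=
  l.foldl (step n r ε O) ⟨0, [], none, [], none, []⟩

theorem runState_append_singleton (n r : ℕ) (ε : ℝ) (O : Oracle α) (l : List α) (e : α) :
    runState n r ε O (l ++ [e]) = step n r ε O (runState n r ε O l) e := by
  simp [runState]

theorem runState_append (n r : ℕ) (ε : ℝ) (O : Oracle α) (l l' : List α) :
    runState n r ε O (l ++ l') = l'.foldl (step n r ε O) (runState n r ε O l) := by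
  simp [runState]

theorem clock_runState (n r : ℕ) (ε : ℝ) (O : Oracle α) (l : List α) :
    (runState n r ε O l).clock = l.length := by
  induction l using List.reverseRecOn with
  | nil => rfl
  | append_singleton l e ih => rw [runState_append_singleton, clock_step, ih]; simp

theorem lengths_runState_le (n r : ℕ) (ε : ℝ) (O : Oracle α) (l : List α) :
    (runState n r ε O l).top.length ≤ l.length ∧ (runState n r ε O l).sel.length ≤ l.length ∧
      (runState n r ε O l).filt.length ≤ l.length := by
  induction l using List.reverseRecOn with
  | nil => simp [runState]
  | append_singleton l e ih =>
    rw [runState_append_singleton, List.length_append, List.length_singleton, top_step]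
    have h1 := length_updateTop_le ε O (runState n r ε O l).top e
    have h2 := length_sel_step_le n r ε O (runState n r ε O l) e
    have h3 := length_filt_step_le n r ε O (runState n r ε O l) e
    omega

theorem inr_mem_words {σ : State α} {k : ℕ} (h : Sum.inr k ∈ σ.words) :
    k = σ.clock ∨ k = σ.top.length ∨ k = σ.sel.length ∨ k = σ.filt.length ∨ k = 0 := by
  have hw : ∀ y : Option α, word y = Sum.inr k → k = 0 := by
    intro y hy
    cases y <;> simp_all [word]
  simp only [State.words, List.mem_append, List.mem_map, List.mem_cons, List.not_mem_nil, or_false,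
    reduceCtorEq, and_false, exists_false, Sum.inr.injEq] at h
  rcases h with (h | ⟨y, -, hy⟩) | h | h
  · tauto
  · have := hw y hy; tauto
  · have := hw _ h.symm; tauto
  · have := hw _ h.symm; tauto

end

end GreedyFiltering

open GreedyFiltering

theorem greedyFiltering_isStreaming (n r : ℕ) (ε : ℝ) : (greedyFiltering n r ε).IsStreaming where
  words_injective := State.words_injective
  stored_init := by
    apply Finset.eq_empty_of_forall_notMem
    intro x hx
    have := mem_stored_iff.1 hx
    simp [greedyFiltering] at this
  stored_step := stored_step n r ε
  step_local := step_local n r ε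
  output_stored O σ := (output_subset O σ).trans (union_subset_stored σ)
  output_local O O' σ h := bestSubset_congr h (union_subset_stored σ)
  word_size := by
    intro O π t k hk
    set l := (OnePassAlgorithm.stream π).take t with hl
    have hlen : l.length ≤ n := by simp [hl, OnePassAlgorithm.stream]
    change Sum.inr k ∈ (runState n r ε O l).words at hk
    have h1 := clock_runState n r ε O l
    obtain ⟨h2, h3, h4⟩ := lengths_runState_le n r ε O l
    rcases inr_mem_words hk with h | h | h | h | h <;> omega

/-! ### Memory -/

namespace GreedyFiltering

section
variable {α : Type} [DecidableEq α]

theorem length_words (σ : State α) :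
    σ.words.length = σ.top.length + σ.sel.length + σ.filt.length + 6 := by
  simp [State.words]
  omega

theorem length_updateTop_le_capacity {ε : ℝ} {O : Oracle α} {top : List α} (e : α)
    (h : top.length ≤ capacity ε) : (updateTop ε O top e).length ≤ capacity ε := by
  unfold updateTop
  split_ifs
  · exact List.length_take_le _ _
  · exact h

theorem length_top_le_capacity (n r : ℕ) (ε : ℝ) (O : Oracle α) (l : List α) :
    (runState n r ε O l).top.length ≤ capacity ε := by
  induction l using List.reverseRecOn with
  | nil => simp [runState]
  | append_singleton l e ih =>
    rw [runState_append_singleton, top_step]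
    exact length_updateTop_le_capacity e ih

theorem length_sel_le (n r : ℕ) (ε : ℝ) (O : Oracle α) (hb : 0 < ⌈ε * (n : ℝ) / (r : ℝ)⌉₊)
    (l : List α) : (runState n r ε O l).sel.length ≤ r := by
  set a := ⌈ε * (n : ℝ)⌉₊ with ha
  set b := ⌈ε * (n : ℝ) / (r : ℝ)⌉₊ with hbdef
  -- Every selector uses up a full window. The truncated subtraction covers the first phase, when
  -- there are no selectors.
  suffices h : (runState n r ε O l).sel.length * b ≤ (runState n r ε O l).clock - a ∧
      (runState n r ε O l).sel.length ≤ r from h.2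
  induction l using List.reverseRecOn with
  | nil => simp [runState]
  | append_singleton l e ih =>
    rw [runState_append_singleton]
    obtain ⟨h1, h2⟩ := ih
    generalize runState n r ε O l = σ at *
    rw [clock_step]
    unfold step
    simp only [← ha, ← hbdef]
    split_ifs with c1 c2 c3
    · exact ⟨by simp only; omega, h2⟩
    · simp only [List.length_append, List.length_singleton]
      obtain ⟨k, hk⟩ := Nat.dvd_of_mod_eq_zero c3
      have h3 : σ.sel.length * b < b * k := by omega
      have h4 : σ.sel.length < k := by
        rw [mul_comm] at h3
        exact Nat.lt_of_mul_lt_mul_left h3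
      have h5 : (σ.sel.length + 1) * b ≤ σ.clock + 1 - a := by
        rw [hk, mul_comm]
        exact Nat.mul_le_mul_left b h4
      refine ⟨h5, ?_⟩
      have h6 : (σ.sel.length + 1) * b ≤ r * b := by omega
      exact Nat.le_of_mul_le_mul_right h6 hb
    · exact ⟨by simp only; omega, h2⟩
    · exact ⟨by simp only; omega, h2⟩

theorem card_levels_le (r : ℕ) (ε w : ℝ) :
    (levels r ε w).card ≤ ⌈2 * Real.logb (1 + ε) ((r : ℝ) / ε)⌉₊ + 1 :=
  Finset.card_image_le.trans (by simp)

/-- The limit is tested before an element is appended, so it is exceeded by at most one. It is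
replaced by a bound free of the set of levels, which still changes while the first phase updates the
best singleton. -/
theorem length_filt_le (n r : ℕ) (ε : ℝ) (O : Oracle α) (l : List α) (hε : 0 < ε)
    (hL : 0 ≤ Real.log ((r : ℝ) / ε)) :
    ((runState n r ε O l).filt.length : ℝ) ≤
      (r : ℝ) * Real.log ((r : ℝ) / ε) *
        ((⌈2 * Real.logb (1 + ε) ((r : ℝ) / ε)⌉₊ + 1 : ℕ) : ℝ) / ε + 1 := by
  induction l using List.reverseRecOn with
  | nil => simp only [runState, List.foldl_nil, List.length_nil, Nat.cast_zero]; positivity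
  | append_singleton l e ih =>
    rw [runState_append_singleton]
    generalize runState n r ε O l = σ at *
    have key : ((updateFilt r ε O σ e).length : ℝ) ≤ (r : ℝ) * Real.log ((r : ℝ) / ε) *
        ((⌈2 * Real.logb (1 + ε) ((r : ℝ) / ε)⌉₊ + 1 : ℕ) : ℝ) / ε + 1 := by
      unfold updateFilt
      simp only
      split_ifs with h
      · rw [List.length_append, List.length_singleton, Nat.cast_add, Nat.cast_one]
        have := card_levels_le r ε (bound r ε O σ.best)
        refine add_le_add_left (h.1.trans ?_) 1
        gcongr
      · exact ih
    unfold step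
    simp only
    split_ifs
    · exact ih
    · exact ih
    · exact ih
    · exact key

end

end GreedyFiltering

/-! ### Numerical estimates for the memory bound. -/

open GreedyFiltering

theorem log_two_le_log_div {r : ℕ} {ε : ℝ} (hr : 1 ≤ r) (hε : 0 < ε) (hε' : ε < 1 / 2) :
    1 / 2 ≤ Real.log ((r : ℝ) / ε) := by
  have h1 : (2 : ℝ) ≤ (r : ℝ) / ε := by
    rw [le_div_iff₀ hε]
    have : (1 : ℝ) ≤ r := by exact_mod_cast hr
    linarith
  have h2 := Real.log_le_log (by norm_num) h1
  have := Real.log_two_gt_d9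
  linarith

theorem memoryUsed_le (n r : ℕ) (ε : ℝ) (O : Oracle (Fin n)) (hn : 1 ≤ n) (hr : 1 ≤ r) (hε : 0 < ε)
    (hε' : ε < 1 / 2) :
    ((greedyFiltering n r ε).memoryUsed O : ℝ) ≤
      15 * ((r : ℝ) * Real.log ((r : ℝ) / ε) ^ 2 / ε ^ 2) := by
  have hr' : (1 : ℝ) ≤ r := by exact_mod_cast hr
  have hn' : (1 : ℝ) ≤ n := by exact_mod_cast hn
  have hL := log_two_le_log_div hr hε hε'
  set L := Real.log ((r : ℝ) / ε) with hLdef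
  set X := (r : ℝ) * L ^ 2 / ε ^ 2 with hX
  -- This lets every lower power of L/ε be absorbed into X = r (L/ε)².
  have hq : 1 ≤ L / ε := by rw [le_div_iff₀ hε]; linarith
  have hXq : X = r * (L / ε) ^ 2 := by rw [hX]; ring
  have hb : 0 < ⌈ε * (n : ℝ) / (r : ℝ)⌉₊ := Nat.ceil_pos.2 (by positivity)
  have hrX : (r : ℝ) ≤ X := by
    rw [hXq]
    exact le_mul_of_one_le_right (by linarith) (one_le_pow₀ hq)
  have hrqX : (r : ℝ) * (L / ε) ≤ X := by
    rw [hXq]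
    gcongr
    nlinarith
  have hcap : (capacity ε : ℝ) ≤ 2 * X := by
    have h1 : Real.log (1 / ε) ≤ L :=
      Real.log_le_log (by positivity) (by gcongr)
    have h2 : (capacity ε : ℝ) ≤ Real.log (1 / ε) / ε + 1 := by
      apply (Nat.ceil_lt_add_one _).le
      apply div_nonneg _ hε.le
      apply Real.log_nonneg
      rw [le_div_iff₀ hε]
      linarith
    have h3 : Real.log (1 / ε) / ε ≤ L / ε := by gcongr
    nlinarith
  -- From ln(1 + ε) ≥ ε/(1 + ε) and ε < 1/2.
  have hlog : 2 / 3 * ε ≤ Real.log (1 + ε) := by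
    have h1 := Real.one_sub_inv_le_log_of_pos (show 0 < 1 + ε by linarith)
    have h2 : (1 + ε)⁻¹ ≤ 1 - 2 / 3 * ε := by
      rw [inv_le_iff_one_le_mul₀ (by linarith)]
      nlinarith
    linarith
  have hN : ((⌈2 * Real.logb (1 + ε) ((r : ℝ) / ε)⌉₊ + 1 : ℕ) : ℝ) ≤ 3 * (L / ε) + 2 := by
    have hl : Real.logb (1 + ε) ((r : ℝ) / ε) = L / Real.log (1 + ε) := rfl
    have hpos : 0 < Real.log (1 + ε) := by nlinarith
    have h1 := Nat.ceil_lt_add_one (show 0 ≤ 2 * Real.logb (1 + ε) ((r : ℝ) / ε) by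
      rw [hl]; positivity)
    have h2 : 2 * Real.logb (1 + ε) ((r : ℝ) / ε) ≤ 3 * (L / ε) := by
      rw [hl]
      calc 2 * (L / Real.log (1 + ε)) ≤ 2 * (L / (2 / 3 * ε)) := by gcongr
        _ = 3 * (L / ε) := by field_simp
    push_cast
    linarith
  have hall : (greedyFiltering n r ε).memoryUsed O ≤ capacity ε + r +
      ⌊(r : ℝ) * L * ((⌈2 * Real.logb (1 + ε) ((r : ℝ) / ε)⌉₊ + 1 : ℕ) : ℝ) / ε + 1⌋₊ + 6 := by
    apply Finset.sup_le
    intro π _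
    apply Finset.sup_le
    intro t _
    change (runState n r ε O ((OnePassAlgorithm.stream π).take t)).words.length ≤ _
    rw [length_words]
    have h1 := length_top_le_capacity n r ε O ((OnePassAlgorithm.stream π).take t)
    have h2 := length_sel_le n r ε O hb ((OnePassAlgorithm.stream π).take t)
    have h3 := Nat.le_floor (length_filt_le n r ε O ((OnePassAlgorithm.stream π).take t) hε
      (by linarith))
    gcongr
  have hall' : ((greedyFiltering n r ε).memoryUsed O : ℝ) ≤ capacity ε + r +
      ⌊(r : ℝ) * L * ((⌈2 * Real.logb (1 + ε) ((r : ℝ) / ε)⌉₊ + 1 : ℕ) : ℝ) / ε + 1⌋₊ + 6 := by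
    exact_mod_cast hall
  have hfl : ((⌊(r : ℝ) * L * ((⌈2 * Real.logb (1 + ε) ((r : ℝ) / ε)⌉₊ + 1 : ℕ) : ℝ) / ε + 1⌋₊ : ℕ) :
      ℝ) ≤ 5 * X + 1 := by
    refine (Nat.floor_le (by positivity)).trans ?_
    have : (r : ℝ) * L * ((⌈2 * Real.logb (1 + ε) ((r : ℝ) / ε)⌉₊ + 1 : ℕ) : ℝ) / ε ≤
        (r : ℝ) * L * (3 * (L / ε) + 2) / ε := by gcongr
    have h2 : (r : ℝ) * L * (3 * (L / ε) + 2) / ε = 3 * X + 2 * (r * (L / ε)) := by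
      rw [hXq]; ring
    linarith
  -- The constant 15: the total is at most 2X + X + (5X + 1) + 6, and X ≥ r ≥ 1.
  linarith

theorem rank_le_of_isInstance {n r : ℕ} {f : Finset (Fin n) → ℝ} {M : Matroid (Fin n)}
    (h : IsInstance n r f M) : r ≤ n := by
  have h1 := M.eRank_le_encard_ground
  rw [h.rank, h.ground, Set.encard_univ] at h1
  simpa using h1

theorem log_div_sq_le {r : ℕ} {ε : ℝ} (hr : 1 ≤ r) (hε : 0 < ε) (hε' : ε < 1 / 2) :
    Real.log ((r : ℝ) / ε) ^ 2 ≤ (1 + Real.log (1 / ε)) ^ 2 * (1 + Real.log (r : ℝ)) ^ 2 := by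
  have hr' : (1 : ℝ) ≤ r := by exact_mod_cast hr
  have h1 : 0 ≤ Real.log (r : ℝ) := Real.log_nonneg hr'
  have h2 : 0 ≤ Real.log (1 / ε) := Real.log_nonneg (by rw [le_div_iff₀ hε]; linarith)
  have h3 : Real.log ((r : ℝ) / ε) = Real.log r + Real.log (1 / ε) := by
    rw [Real.log_div (by linarith) hε.ne', Real.log_div one_ne_zero hε.ne', Real.log_one]
    ring
  rw [h3, ← mul_pow]
  gcongr
  nlinarith

/-! ### Submodular functions -/

section
variable {α : Type} [DecidableEq α]

/-- Marginal values decrease. -/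
theorem Submodular.insert_sub_le {f : Finset α → ℝ} (hf : Submodular f) {A B : Finset α}
    (h : A ⊆ B) {x : α} (hx : x ∉ B) : f (insert x B) - f B ≤ f (insert x A) - f A := by
  have h1 := hf (insert x A) B
  have e1 : insert x A ∪ B = insert x B := by
    rw [Finset.insert_union, Finset.union_eq_right.2 h]
  have e2 : insert x A ∩ B = A := by
    rw [Finset.insert_inter_of_notMem hx, Finset.inter_eq_left.2 h]
  rw [e1, e2] at h1
  linarith

/-- The elements of Y are added one at a time, and each marginal is compared with the one at the
smaller set Z. It is applied with Z = S_r and X = P ∪ S_r. -/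
theorem Submodular.union_le_add_sum {f : Finset α → ℝ} (hf : Submodular f) {Z X : Finset α}
    (h : Z ⊆ X) (Y : Finset α) (hY : Disjoint Y X) :
    f (X ∪ Y) ≤ f X + ∑ y ∈ Y, (f (insert y Z) - f Z) := by
  induction Y using Finset.induction_on with
  | empty => simp
  | insert y Y hy ih =>
    rw [Finset.disjoint_insert_left] at hY
    rw [Finset.sum_insert hy, Finset.union_insert]
    have := hf.insert_sub_le (h.trans Finset.subset_union_left : Z ⊆ X ∪ Y) (x := y)
      (by simp [hY.1, hy])
    linarith [ih hY.2]

theorem Submodular.insert_le_singleton {f : Finset α → ℝ} (hf : Submodular f)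
    (h0 : ∀ X, 0 ≤ f X) {A : Finset α} {x : α} : f (insert x A) - f A ≤ f {x} := by
  have := hf {x} A
  rw [← Finset.insert_eq] at this
  linarith [h0 ({x} ∩ A)]

/-- Elements are revealed in order of decreasing frequency. Each step gains at least its frequency
times the marginal at the full prefix, and Abel summation leaves non-negative weights on the
prefixes. The term with c is the induction form of this: c is a lower bound for the frequencies so
far, and in the step the hypothesis is used with c equal to the frequency of the new, least frequent
element. -/
theorem Submodular.sampling_aux {Ω : Type} [Fintype Ω] {h : Finset α → ℝ} (hf : Submodular h)
    (h0 : ∀ X, 0 ≤ h X) (R : Ω → Finset α) {p : ℝ} (U : Finset α)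
    (hp : ∀ x ∈ U, ((Finset.univ.filter fun ω => x ∈ R ω).card : ℝ) ≤ p) :
    ∀ c : ℝ, c ≤ p → (∀ x ∈ U, c ≤ ((Finset.univ.filter fun ω => x ∈ R ω).card : ℝ)) →
      (Fintype.card Ω - p) * h ∅ + c * h U ≤ ∑ ω, h (R ω ∩ U) := by
  induction U using Finset.induction_on_min_value
    (fun x => (Finset.univ.filter fun ω => x ∈ R ω).card) with
  | empty =>
    intro c hc _
    simp only [Finset.inter_empty, Finset.sum_const, Finset.card_univ, nsmul_eq_mul]
    nlinarith [h0 ∅]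
  | insert a U ha hmin ih =>
    intro c hc hcU
    set q : ℝ := ((Finset.univ.filter fun ω => a ∈ R ω).card : ℝ) with hq
    have hqp : q ≤ p := hp a (Finset.mem_insert_self _ _)
    have h1 := ih (fun x hx => hp x (Finset.mem_insert_of_mem hx)) q hqp
      (fun x hx => by rw [hq]; exact_mod_cast hmin x hx)
    have h2 : ∀ ω, h (R ω ∩ U) + (if a ∈ R ω then h (insert a U) - h U else 0) ≤
        h (R ω ∩ insert a U) := by
      intro ω
      split_ifs with hω
      · rw [Finset.inter_insert_of_mem hω]
        have := hf.insert_sub_le (Finset.inter_subset_right : R ω ∩ U ⊆ U) ha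
        linarith
      · rw [Finset.inter_insert_of_notMem hω]
        simp
    have h3 := Finset.sum_le_sum fun ω (_ : ω ∈ Finset.univ) => h2 ω
    rw [Finset.sum_add_distrib, ← Finset.sum_filter, Finset.sum_const, nsmul_eq_mul, ← hq] at h3
    have h4 : c * h (insert a U) ≤ q * h (insert a U) :=
      mul_le_mul_of_nonneg_right (hcU a (Finset.mem_insert_self _ _)) (h0 _)
    nlinarith

/-- If a random set contains no element with probability more than `p`, its expected value under a
non-negative submodular function `h` is at least `(1 - p) h(∅)`. -/
theorem Submodular.sampling {Ω : Type} [Fintype Ω] [Fintype α] {h : Finset α → ℝ}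
    (hf : Submodular h) (h0 : ∀ X, 0 ≤ h X) (R : Ω → Finset α) {p : ℝ} (hp0 : 0 ≤ p)
    (hp : ∀ x, ((Finset.univ.filter fun ω => x ∈ R ω).card : ℝ) ≤ p) :
    (Fintype.card Ω - p) * h ∅ ≤ ∑ ω, h (R ω) := by
  have := hf.sampling_aux h0 R Finset.univ (fun x _ => hp x) 0 hp0 (fun x _ => Nat.cast_nonneg _)
  simpa using this

/-- A random set that misses each element of `P` and contains each element outside `P` with
probability at most `p` has expected value at least `(1 - 2p) f(P)`. -/
theorem Submodular.sampling_near {Ω : Type} [Fintype Ω] [Fintype α] {f : Finset α → ℝ}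
    (hf : Submodular f) (h0 : ∀ X, 0 ≤ f X) (P : Finset α) (R : Ω → Finset α) {p : ℝ} (hp0 : 0 ≤ p)
    (hp : ∀ x ∉ P, ((Finset.univ.filter fun ω => x ∈ R ω).card : ℝ) ≤ p)
    (hp' : ∀ x ∈ P, ((Finset.univ.filter fun ω => x ∉ R ω).card : ℝ) ≤ p) :
    (Fintype.card Ω - 2 * p) * f P ≤ ∑ ω, f (R ω) := by
  have s1 : Submodular fun X => f (P ∪ X) := by
    intro X Y
    have := hf (P ∪ X) (P ∪ Y)
    rw [← Finset.union_inter_distrib_left, ← Finset.union_union_distrib_left] at this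
    exact this
  have s2 : Submodular fun X => f (P \ X) := by
    intro X Y
    have := hf (P \ X) (P \ Y)
    rw [← Finset.sdiff_inter_distrib_right, ← Finset.sdiff_union_distrib] at this
    linarith
  have h1 := s1.sampling (fun X => h0 _) (fun ω => R ω \ P) hp0 (by
    intro x
    by_cases hx : x ∈ P
    · simpa [hx] using hp0
    · simpa [hx] using hp x hx)
  have h2 := s2.sampling (fun X => h0 _) (fun ω => P \ R ω) hp0 (by
    intro x
    by_cases hx : x ∈ P
    · simpa [hx] using hp' x hx
    · simpa [hx] using hp0)
  -- The insertions and the deletions each cost a fraction p of f(P); submodularity on P and R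
  -- recombines them, and one copy of f(P) is subtracted.
  have h3 : ∀ ω, f (P ∪ R ω \ P) + f (P \ (P \ R ω)) ≤ f (R ω) + f P := by
    intro ω
    rw [Finset.union_sdiff_self_eq_union,
      show P \ (P \ R ω) = P ∩ R ω by ext x; simp]
    have := hf (R ω) P
    rwa [Finset.union_comm, Finset.inter_comm] at this
  have h4 := Finset.sum_le_sum fun ω (_ : ω ∈ Finset.univ) => h3 ω
  rw [Finset.sum_add_distrib, Finset.sum_add_distrib, Finset.sum_const, Finset.card_univ,
    nsmul_eq_mul] at h4
  simp only [Finset.union_empty, Finset.sdiff_empty] at h1 h2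
  linarith

end

/-! ### Combining a greedy chain with a part of an independent set -/

section
variable {α : Type} [DecidableEq α]

open Classical in
/-- The part of a chain `S` that can be added to `P` greedily, keeping independence. -/
noncomputable def keptPart (M : Matroid α) (P : Finset α) (S : ℕ → Finset α) : ℕ → Finset α
  | 0 => ∅
  | i + 1 =>
    if M.Indep ((P ∪ (keptPart M P S i ∪ (S (i + 1) \ S i)) : Finset α) : Set α) then
      keptPart M P S i ∪ (S (i + 1) \ S i)
    else keptPart M P S i

open Classical in
/-- The indices below `d` at which nothing of the chain is rejected. -/
noncomputable def keptIndices (M : Matroid α) (P : Finset α) (S : ℕ → Finset α) (d : ℕ) :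
    Finset ℕ :=
  (Finset.range d).filter fun i =>
    M.Indep ((P ∪ (keptPart M P S i ∪ (S (i + 1) \ S i)) : Finset α) : Set α)

/-- Facts about a prefix of the greedy walk. `card_eq` holds because a rejected index adds an
element to the chain only, whereas a kept one adds the same to both sets. `card_le` need not be an
equality: an index where the chain stands still counts as kept. `span` says that only elements in
the span of P and the kept part are rejected. -/
structure KeptInvariant (M : Matroid α) (P : Finset α) (S : ℕ → Finset α) (f : Finset α → ℝ)
    (d : ℕ) : Prop where
  subset : keptPart M P S d ⊆ S d
  indep : M.Indep ((P ∪ keptPart M P S d : Finset α) : Set α)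
  span : (S d : Set α) ⊆ M.closure ((P ∪ keptPart M P S d : Finset α) : Set α)
  card_le : (keptPart M P S d).card ≤ (keptIndices M P S d).card
  card_eq : d + (keptPart M P S d).card = (S d).card + (keptIndices M P S d).card
  value : f ∅ + ∑ i ∈ keptIndices M P S d, (f (S (i + 1)) - f (S i)) ≤ f (keptPart M P S d)

theorem keptInvariant {M : Matroid α} {P : Finset α} {S : ℕ → Finset α} {f : Finset α → ℝ}
    (hf : Submodular f) (hM : M.E = Set.univ) (hP : M.Indep (P : Set α)) (hS0 : S 0 = ∅) (r : ℕ)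
    (hS : ∀ i < r, S (i + 1) = S i ∨ ∃ x ∉ S i, S (i + 1) = insert x (S i)) :
    ∀ d ≤ r, KeptInvariant M P S f d := by
  intro d
  induction d with
  | zero =>
    intro _
    exact ⟨by simp [keptPart], by simpa [keptPart] using hP, by simp [hS0], by simp [keptPart],
      by simp [keptPart, keptIndices, hS0], by simp [keptPart, keptIndices]⟩
  | succ d ih =>
    intro hd
    obtain ⟨i1, i2, i3, i4, i5, i6⟩ := ih (by omega)
    have hnot : d ∉ keptIndices M P S d := by simp [keptIndices]
    by_cases hk : M.Indep ((P ∪ (keptPart M P S d ∪ (S (d + 1) \ S d)) : Finset α) : Set α)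
    · have eA : keptPart M P S (d + 1) = keptPart M P S d ∪ (S (d + 1) \ S d) := by
        rw [keptPart, if_pos hk]
      have eN : keptIndices M P S (d + 1) = insert d (keptIndices M P S d) := by
        rw [keptIndices, Finset.range_add_one, Finset.filter_insert, if_pos hk]
        rfl
      rcases hS d (by omega) with h | ⟨x, hx, h⟩
      · have eA' : keptPart M P S (d + 1) = keptPart M P S d := by rw [eA, h]; simp
        refine ⟨?_, ?_, ?_, ?_, ?_, ?_⟩ <;> rw [eA']
        · rw [h]; exact i1
        · exact i2
        · rw [h]; exact i3
        · rw [eN, Finset.card_insert_of_notMem hnot]; omega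
        · rw [eN, Finset.card_insert_of_notMem hnot, h]; omega
        · rw [eN, Finset.sum_insert hnot, h]; linarith
      · have e1 : S (d + 1) \ S d = {x} := by
          rw [h, Finset.insert_sdiff_of_notMem _ hx]; simp
        have eA' : keptPart M P S (d + 1) = insert x (keptPart M P S d) := by
          rw [eA, e1, Finset.union_comm]; rfl
        have hxA : x ∉ keptPart M P S d := fun hh => hx (i1 hh)
        refine ⟨?_, ?_, ?_, ?_, ?_, ?_⟩
        · rw [eA', h]; exact Finset.insert_subset_insert _ i1
        · rw [eA]; exact hk
        · rw [h, Finset.coe_insert, Set.insert_subset_iff]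
          constructor
          · apply M.mem_closure_of_mem
            rw [eA']; simp
          · refine i3.trans (M.closure_subset_closure ?_)
            rw [eA', Finset.coe_subset]
            exact Finset.union_subset_union_right (Finset.subset_insert _ _)
        · rw [eA', eN, Finset.card_insert_of_notMem hnot, Finset.card_insert_of_notMem hxA]; omega
        · rw [eA', eN, h, Finset.card_insert_of_notMem hnot, Finset.card_insert_of_notMem hxA,
            Finset.card_insert_of_notMem hx]; omega
        · rw [eA', eN, Finset.sum_insert hnot, h]
          have := hf.insert_sub_le i1 hx
          linarith
    · have eA : keptPart M P S (d + 1) = keptPart M P S d := by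
        rw [keptPart, if_neg hk]
      have eN : keptIndices M P S (d + 1) = keptIndices M P S d := by
        rw [keptIndices, Finset.range_add_one, Finset.filter_insert, if_neg hk]
        rfl
      rcases hS d (by omega) with h | ⟨x, hx, h⟩
      -- Rejection is impossible where the chain stands still.
      · rw [h] at hk
        simp only [Finset.sdiff_self, Finset.union_empty] at hk
        exact absurd i2 hk
      · have e1 : S (d + 1) \ S d = {x} := by
          rw [h, Finset.insert_sdiff_of_notMem _ hx]; simp
        refine ⟨?_, ?_, ?_, ?_, ?_, ?_⟩ <;> rw [eA]
        · rw [h]; exact i1.trans (Finset.subset_insert _ _)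
        · exact i2
        · rw [h, Finset.coe_insert, Set.insert_subset_iff]
          refine ⟨?_, i3⟩
          -- A rejected element outside the closure would have extended P and the kept part
          -- independently.
          by_contra hcl
          apply hk
          have e2 : P ∪ (keptPart M P S d ∪ {x}) = insert x (P ∪ keptPart M P S d) := by
            ext y; simp
          rw [e1, e2, Finset.coe_insert, i2.insert_indep_iff]
          left
          exact ⟨by rw [hM]; exact Set.mem_univ _, hcl⟩
        · rw [eN]; exact i4
        · rw [eN, h, Finset.card_insert_of_notMem hx]; omega
        · rw [eN]; exact i6

theorem Matroid.Indep.card_le_of_subset_closure {M : Matroid α} {X Y : Finset α}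
    (hX : M.Indep (X : Set α)) (h : (X : Set α) ⊆ M.closure (Y : Set α)) : X.card ≤ Y.card := by
  have h1 := hX.encard_le_eRk_of_subset h
  rw [M.eRk_closure_eq] at h1
  have h2 := h1.trans (M.eRk_le_encard _)
  rw [Set.encard_coe_eq_coe_finsetCard, Set.encard_coe_eq_coe_finsetCard] at h2
  exact_mod_cast h2

/-- The elements of `L` can be matched to kept indices at which they could have been chosen. -/
theorem exists_matching {M : Matroid α} {P L : Finset α} {S : ℕ → Finset α} {f : Finset α → ℝ}
    {r : ℕ} (hM : M.E = Set.univ) (hPL : M.Indep ((P ∪ L : Finset α) : Set α)) (hd : Disjoint P L)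
    (hcard : (P ∪ L).card ≤ r) (hSr : M.Indep (S r : Set α))
    (hmono : ∀ i ≤ r, S i ⊆ S r)
    (inv : ∀ d ≤ r, KeptInvariant M P S f d) :
    ∃ φ : L → ℕ, Function.Injective φ ∧ ∀ o : L, φ o ∈ keptIndices M P S r ∧
      M.Indep ((insert o.1 (S (φ o)) : Finset α) : Set α) := by
  classical
  -- Hall's theorem; an element of L is adjacent to the kept indices at which it could have been
  -- chosen.
  have hall := (Finset.all_card_le_biUnion_card_iff_exists_injective
    (fun o : L => (keptIndices M P S r).filter fun i =>
      M.Indep ((insert o.1 (S i) : Finset α) : Set α))).1 ?_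
  · obtain ⟨φ, h1, h2⟩ := hall
    exact ⟨φ, h1, fun o => by simpa using h2 o⟩
  intro X
  -- As long as P ∪ S_i does not span all of X, some element of X is outside the span of S_i, so the
  -- index i, if kept, is a neighbour of X.
  have hunion : ∀ d, (∀ i < d, i < r → ∃ x ∈ X, (x : α) ∉ M.closure ((P ∪ S i : Finset α) : Set α)) →
      keptIndices M P S d ∩ Finset.range r ⊆ X.biUnion (fun o : L => (keptIndices M P S r).filter fun i =>
        M.Indep ((insert o.1 (S i) : Finset α) : Set α)) := by
    intro d hx i hi
    simp only [keptIndices, Finset.mem_inter, Finset.mem_filter, Finset.mem_range] at hi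
    obtain ⟨x, hxX, hxi⟩ := hx i hi.1.1 hi.2
    simp only [Finset.mem_biUnion, Finset.mem_filter]
    refine ⟨x, hxX, ?_, ?_⟩
    · simp only [keptIndices, Finset.mem_filter, Finset.mem_range]
      exact ⟨hi.2, hi.1.2⟩
    · have hSi : M.Indep (S i : Set α) := hSr.subset (by exact_mod_cast hmono i hi.2.le)
      rw [Finset.coe_insert, hSi.insert_indep_iff]
      left
      refine ⟨by rw [hM]; trivial, fun hcl => hxi (M.closure_subset_closure ?_ hcl)⟩
      simp
  have hXL : X.map (Function.Embedding.subtype _) ⊆ L := by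
    intro x hx
    simp only [Finset.mem_map, Function.Embedding.coe_subtype] at hx
    obtain ⟨y, -, rfl⟩ := hx
    exact y.2
  -- Take the first d at which P ∪ S_d spans X. All kept indices below d are neighbours, and P ∪ X,
  -- independent and spanned by P and the kept part at d, is no larger than that union; so |X| is at
  -- most the number of these indices.
  by_cases hex : ∃ d ≤ r, ∀ x ∈ X, (x : α) ∈ M.closure ((P ∪ S d : Finset α) : Set α)
  · obtain ⟨hd1, hd2⟩ := Nat.find_spec hex
    set d := Nat.find hex
    have hsub := hunion d (by
      intro i hi hir
      have := Nat.find_min hex hi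
      push Not at this
      exact this hir.le)
    have hInd : M.Indep ((P ∪ X.map (Function.Embedding.subtype _) : Finset α) : Set α) :=
      hPL.subset (by exact_mod_cast Finset.union_subset_union_right hXL)
    obtain ⟨i1, i2, i3, i4, i5, i6⟩ := inv d hd1
    have hcl : ((P ∪ S d : Finset α) : Set α) ⊆
        M.closure ((P ∪ keptPart M P S d : Finset α) : Set α) := by
      rw [Finset.coe_union, Set.union_subset_iff]
      refine ⟨fun x hx => M.mem_closure_of_mem (by simp at hx ⊢; tauto) ?_, i3⟩
      rw [hM]; exact Set.subset_univ _
    have hle := hInd.card_le_of_subset_closure (Y := P ∪ keptPart M P S d) (by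
      rw [Finset.coe_union, Set.union_subset_iff]
      constructor
      · exact (by simp : (P : Set α) ⊆ ((P ∪ S d : Finset α) : Set α)).trans hcl
      · intro x hx
        simp only [Finset.coe_map, Function.Embedding.coe_subtype, Set.mem_image,
          Finset.mem_coe] at hx
        obtain ⟨y, hy, rfl⟩ := hx
        exact M.closure_subset_closure_of_subset_closure hcl (hd2 y hy))
    rw [Finset.card_union_of_disjoint (hd.mono_right hXL), Finset.card_map] at hle
    have h5 := Finset.card_union_le P (keptPart M P S d)
    have h6 : keptIndices M P S d ∩ Finset.range r = keptIndices M P S d := by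
      rw [Finset.inter_eq_left]
      exact (Finset.filter_subset _ _).trans (Finset.range_subset_range.2 hd1)
    rw [h6] at hsub
    have := Finset.card_le_card hsub
    omega
  -- If X is never spanned, all kept indices are neighbours. Their number is r - |S_r| + |A| with A
  -- the kept part, hence at least r - |P| ≥ |L|, since S_r is independent and spanned by P ∪ A.
  · push Not at hex
    have hsub := hunion r (fun i _ hir => hex i hir.le)
    obtain ⟨i1, i2, i3, i4, i5, i6⟩ := inv r le_rfl
    have hle := hSr.card_le_of_subset_closure i3
    have h5 := Finset.card_union_le P (keptPart M P S r)
    have h6 : keptIndices M P S r ∩ Finset.range r = keptIndices M P S r := by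
      rw [Finset.inter_eq_left]
      exact (Finset.filter_subset _ _)
    rw [h6] at hsub
    have h7 := Finset.card_le_card hsub
    have h8 := Finset.card_le_card hXL
    rw [Finset.card_map] at h8
    rw [Finset.card_union_of_disjoint hd] at hcard
    omega

/-- The value of the union of a greedy chain with an independent set `P ∪ L`, where the elements of
`L` are almost dominated by the elements of the chain. -/
theorem exists_hybrid {M : Matroid α} {P L : Finset α} {S : ℕ → Finset α} {f : Finset α → ℝ}
    {r : ℕ} {ε m : ℝ} (hf : Submodular f) (h0 : ∀ X, 0 ≤ f X) (hM : M.E = Set.univ)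
    (hε : 0 ≤ ε) (hm : 0 ≤ m)
    (hPL : M.Indep ((P ∪ L : Finset α) : Set α)) (hd : Disjoint P L)
    (hcard : (P ∪ L).card ≤ r) (hS0 : S 0 = ∅) (hSr : M.Indep (S r : Set α))
    (hS : ∀ i < r, S (i + 1) = S i ∨ ∃ x ∉ S i, S (i + 1) = insert x (S i))
    (hdS : Disjoint (P ∪ L) (S r))
    (hg : ∀ i < r, 1 ≤ i → f (S i) ≤ f (S (i + 1)))
    (hL : ∀ o ∈ L, ∀ i < r, M.Indep ((insert o (S i) : Finset α) : Set α) →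
      f (insert o (S i)) - f (S i) ≤ (1 + ε) * (max (f (S (i + 1)) - f (S i)) 0 + m)) :
    ∃ A ⊆ S r, M.Indep ((P ∪ A : Finset α) : Set α) ∧
      f (P ∪ L ∪ S r) ≤ f (P ∪ A) + f (S r) - f A + (1 + ε) * (f A + r * m) := by
  classical
  have hmono : ∀ i ≤ r, S i ⊆ S r := by
    intro i hi
    obtain ⟨k, rfl⟩ := Nat.exists_eq_add_of_le hi
    have : ∀ j ≤ k, S i ⊆ S (i + j) := by
      intro j
      induction j with
      | zero => intro _; exact subset_rfl
      | succ j ih =>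
        intro hj
        refine (ih (by omega)).trans ?_
        rcases hS (i + j) (by omega) with h | ⟨x, -, h⟩ <;> rw [← add_assoc, h]
        exact Finset.subset_insert _ _
    exact this k le_rfl
  have hP : M.Indep (P : Set α) := hPL.subset (by simp)
  have inv := keptInvariant hf hM hP hS0 r hS
  obtain ⟨φ, hφ, hφ'⟩ := exists_matching hM hPL hd hcard hSr hmono inv
  obtain ⟨i1, i2, i3, i4, i5, i6⟩ := inv r le_rfl
  set A := keptPart M P S r with hA
  set N := keptIndices M P S r with hN
  refine ⟨A, i1, i2, ?_⟩
  have hNr : ∀ i ∈ N, i < r := fun i hi => by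
    have := (Finset.mem_filter.1 hi).1
    simpa using this
  -- Only the gain at index 0 may be negative, and the value of the empty set in the invariant pays
  -- for replacing it by zero.
  have hval : ∑ i ∈ N, max (f (S (i + 1)) - f (S i)) 0 ≤ f A := by
    have h1 : ∑ i ∈ N, max (f (S (i + 1)) - f (S i)) 0 ≤
        ∑ i ∈ N, ((f (S (i + 1)) - f (S i)) + if i = 0 then f ∅ else 0) := by
      apply Finset.sum_le_sum
      intro i hi
      by_cases hi0 : i = 0
      · subst hi0
        rw [if_pos rfl, hS0]
        apply max_le <;> linarith [h0 ∅, h0 (S (0 + 1))]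
      · have := hg i (hNr i hi) (by omega)
        rw [if_neg hi0, max_eq_left (by linarith)]
        linarith
    have h2 : ∑ i ∈ N, (if i = 0 then f ∅ else 0) ≤ f ∅ := by
      rw [Finset.sum_ite_eq']
      split_ifs
      · exact le_rfl
      · exact h0 ∅
    rw [Finset.sum_add_distrib] at h1
    linarith
  have hsumL : ∑ o ∈ L, (f (insert o (S r)) - f (S r)) ≤ (1 + ε) * (f A + r * m) := by
    have hoS : ∀ o ∈ L, o ∉ S r := fun o ho h =>
      Finset.disjoint_left.1 hdS (Finset.mem_union_right _ ho) h
    have h1 : ∀ o : L, f (insert o.1 (S r)) - f (S r) ≤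
        (1 + ε) * (max (f (S (φ o + 1)) - f (S (φ o))) 0 + m) := by
      intro o
      have hr := hNr _ (hφ' o).1
      exact (hf.insert_sub_le (hmono _ hr.le) (hoS o o.2)).trans (hL o o.2 _ hr (hφ' o).2)
    rw [← Finset.sum_coe_sort L]
    refine (Finset.sum_le_sum fun o _ => h1 o).trans ?_
    rw [← Finset.mul_sum]
    refine mul_le_mul_of_nonneg_left ?_ (by linarith)
    have h2 : ∑ o : L, (max (f (S (φ o + 1)) - f (S (φ o))) 0 + m) =
        ∑ i ∈ Finset.univ.map ⟨φ, hφ⟩, (max (f (S (i + 1)) - f (S i)) 0 + m) := by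
      rw [Finset.sum_map]; rfl
    rw [h2]
    have h3 : Finset.univ.map ⟨φ, hφ⟩ ⊆ N := by
      intro i hi
      simp only [Finset.mem_map, Finset.mem_univ, true_and, Function.Embedding.coeFn_mk] at hi
      obtain ⟨o, rfl⟩ := hi
      exact (hφ' o).1
    refine (Finset.sum_le_sum_of_subset_of_nonneg h3 fun i _ _ => ?_).trans ?_
    · have := le_max_right (f (S (i + 1)) - f (S i)) 0
      linarith
    · rw [Finset.sum_add_distrib, Finset.sum_const, nsmul_eq_mul]
      have : (N.card : ℝ) ≤ r := by
        have := Finset.card_le_card (Finset.filter_subset _ _ : N ⊆ Finset.range r)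
        rw [Finset.card_range] at this
        exact_mod_cast this
      gcongr
  have h1 : f (P ∪ S r ∪ L) ≤ f (P ∪ S r) + ∑ o ∈ L, (f (insert o (S r)) - f (S r)) := by
    apply hf.union_le_add_sum Finset.subset_union_right
    rw [Finset.disjoint_union_right]
    exact ⟨hd.symm, hdS.mono_left Finset.subset_union_right⟩
  -- Submodularity for P ∪ A and S_r, which meet exactly in A because P is disjoint from the chain.
  have h2 : f (P ∪ S r) + f A ≤ f (P ∪ A) + f (S r) := by
    have := hf (P ∪ A) (S r)
    have e1 : P ∪ A ∪ S r = P ∪ S r := by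
      rw [Finset.union_assoc, Finset.union_eq_right.2 i1]
    have e2 : (P ∪ A) ∩ S r = A := by
      rw [Finset.union_inter_distrib_right, Finset.inter_eq_left.2 i1,
        Finset.disjoint_iff_inter_eq_empty.1 (hdS.mono_left Finset.subset_union_left),
        Finset.empty_union]
    rwa [e1, e2] at this
  rw [Finset.union_right_comm]
  linarith

end

/-! ### Uniformly random permutations -/

section
variable {n : ℕ}

open Equiv in
/-- Conditioned on what happened before time `q`, a set `D` of elements that have not arrived yet
is hit at time `q` with probability `|D| / (n - q)`. -/
theorem card_hit_mul (q : Fin n) (E : Finset (Perm (Fin n))) (D : Perm (Fin n) → Finset (Fin n))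
    (K : ℕ)
    (hE : ∀ p, q ≤ p → ∀ π, π ∈ E → π * swap q p ∈ E)
    (hD : ∀ p, q ≤ p → ∀ π, D (π * swap q p) = D π)
    (hK : ∀ π ∈ E, (D π).card = K)
    (hlate : ∀ π ∈ E, ∀ p, π p ∈ D π → q ≤ p) :
    (E.filter fun π => π q ∈ D π).card * (n - q) = K * E.card := by
  -- Swapping positions q and p preserves the past and exchanges the hits at these positions, so all
  -- positions from q on are hit equally often. Their hits total |D| per order, since D arrives
  -- entirely from q on.
  have h1 : ∀ p ∈ Finset.Ici q, (E.filter fun π => π p ∈ D π).card =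
      (E.filter fun π => π q ∈ D π).card := by
    intro p hp
    rw [Finset.mem_Ici] at hp
    refine Finset.card_bij' (fun π _ => π * swap q p) (fun π _ => π * swap q p) ?_ ?_ ?_ ?_
    · intro π hπ
      rw [Finset.mem_filter] at hπ ⊢
      refine ⟨hE p hp π hπ.1, ?_⟩
      rw [hD p hp]
      simpa using hπ.2
    · intro π hπ
      rw [Finset.mem_filter] at hπ ⊢
      refine ⟨hE p hp π hπ.1, ?_⟩
      rw [hD p hp]
      simpa using hπ.2
    · intro π _; simp [mul_assoc]
    · intro π _; simp [mul_assoc]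
  have h2 : ∑ p ∈ Finset.Ici q, (E.filter fun π => π p ∈ D π).card =
      (E.filter fun π => π q ∈ D π).card * (n - q) := by
    rw [Finset.sum_congr rfl h1, Finset.sum_const, Fin.card_Ici, smul_eq_mul, mul_comm]
  rw [← h2]
  simp only [Finset.card_filter]
  rw [Finset.sum_comm]
  rw [mul_comm, ← smul_eq_mul, ← Finset.sum_const]
  apply Finset.sum_congr rfl
  intro π hπ
  rw [← Finset.card_filter, ← hK π hπ]
  refine Finset.card_bij (fun p _ => π p) ?_ ?_ ?_
  · intro p hp
    exact (Finset.mem_filter.1 hp).2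
  · intro p _ p' _ h
    exact π.injective h
  · intro x hx
    refine ⟨π.symm x, ?_, by simp⟩
    rw [Finset.mem_filter, Finset.mem_Ici]
    exact ⟨hlate π hπ _ (by simpa using hx), by simpa using hx⟩

-- Weakens the hitting probability from K/(n - q) to K/n, so that the bound is the same at every
-- position of a window.
open Equiv in
theorem card_miss_le (q : Fin n) (E : Finset (Perm (Fin n))) (D : Perm (Fin n) → Finset (Fin n))
    (K : ℕ)
    (hE : ∀ p, q ≤ p → ∀ π, π ∈ E → π * swap q p ∈ E)
    (hD : ∀ p, q ≤ p → ∀ π, D (π * swap q p) = D π)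
    (hK : ∀ π ∈ E, (D π).card = K)
    (hlate : ∀ π ∈ E, ∀ p, π p ∈ D π → q ≤ p) :
    ((E.filter fun π => π q ∉ D π).card : ℝ) ≤ (1 - (K : ℝ) / n) * E.card := by
  have h := card_hit_mul q E D K hE hD hK hlate
  have hn : (0 : ℝ) < n := by exact_mod_cast (Fin.pos q)
  have h1 := Finset.card_filter_add_card_filter_not (s := E) (fun π => π q ∈ D π)
  have h2 : K * E.card ≤ (E.filter fun π => π q ∈ D π).card * n := by
    rw [← h]; exact Nat.mul_le_mul_left _ (Nat.sub_le _ _)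
  have h2' : (K : ℝ) * E.card ≤ (E.filter fun π => π q ∈ D π).card * n := by exact_mod_cast h2
  have h3 : (K : ℝ) / n * E.card ≤ (E.filter fun π => π q ∈ D π).card := by
    rw [div_mul_eq_mul_div, div_le_iff₀ hn]
    exact h2'
  have h1' : ((E.filter fun π => π q ∈ D π).card : ℝ) + (E.filter fun π => π q ∉ D π).card =
      E.card := by exact_mod_cast h1
  linarith

open Equiv in
/-- A window of `b` consecutive positions from `t` on misses a set of `K` elements, determined by
what happened before time `t` and not yet arrived then, with probability at most `(1 - K/n)^b`. -/
theorem card_window_miss_le (t b K : ℕ) (htb : t + b ≤ n) (E : Finset (Perm (Fin n)))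
    (D : Perm (Fin n) → Finset (Fin n))
    (hE : ∀ p p' : Fin n, t ≤ p → t ≤ p' → ∀ π, π ∈ E → π * swap p p' ∈ E)
    (hD : ∀ p p' : Fin n, t ≤ p → t ≤ p' → ∀ π, D (π * swap p p') = D π)
    (hK : ∀ π ∈ E, (D π).card = K)
    (hlate : ∀ π ∈ E, ∀ p : Fin n, π p ∈ D π → t ≤ p) :
    ((E.filter fun π => ∀ p : Fin n, t ≤ p → (p : ℕ) < t + b → π p ∉ D π).card : ℝ) ≤
      (1 - (K : ℝ) / n) ^ b * E.card := by
  rcases E.eq_empty_or_nonempty with rfl | ⟨π₀, hπ₀⟩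
  · simp
  have hKn : (K : ℝ) / n ≤ 1 := by
    apply div_le_one_of_le₀ _ (Nat.cast_nonneg _)
    rw [← hK π₀ hπ₀]
    exact_mod_cast (Finset.card_le_univ _).trans (by simp)
  induction b with
  | zero =>
    rw [Finset.filter_true_of_mem]
    · simp
    · intro π _ p h1 h2
      omega
  | succ b ih =>
    have hq : t + b < n := by omega
    set q : Fin n := ⟨t + b, hq⟩ with hqdef
    set E' := E.filter fun π => ∀ p : Fin n, t ≤ p → (p : ℕ) < t + b → π p ∉ D π with hE'
    -- Having been missed up to t + b, the set D still lies entirely ahead, so the one-position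
    -- bound applies again to the surviving orders.
    have step : ((E'.filter fun π => π q ∉ D π).card : ℝ) ≤ (1 - (K : ℝ) / n) * E'.card := by
      apply card_miss_le
      · intro p hp π hπ
        have hp' : t + b ≤ (p : ℕ) := hp
        rw [hE', Finset.mem_filter] at hπ ⊢
        refine ⟨hE q p (by simp [hqdef]) (by omega) π hπ.1, ?_⟩
        intro p' h1 h2
        rw [hD q p (by simp [hqdef]) (by omega), Perm.mul_apply, swap_apply_of_ne_of_ne]
        · exact hπ.2 p' h1 h2
        · rintro rfl; simp [hqdef] at h2
        · rintro rfl; omega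
      · intro p hp π
        have hp' : t + b ≤ (p : ℕ) := hp
        exact hD q p (by simp [hqdef]) (by omega) π
      · intro π hπ
        exact hK π (Finset.mem_filter.1 hπ).1
      · intro π hπ p hp
        rw [hE', Finset.mem_filter] at hπ
        have h1 := hlate π hπ.1 p hp
        by_contra hlt
        exact hπ.2 p h1 (by simpa [hqdef, Fin.lt_def] using not_le.1 hlt) hp
    have heq : (E.filter fun π => ∀ p : Fin n, t ≤ p → (p : ℕ) < t + (b + 1) → π p ∉ D π) =
        E'.filter fun π => π q ∉ D π := by
      rw [hE', Finset.filter_filter]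
      apply Finset.filter_congr
      intro π _
      constructor
      · intro h
        exact ⟨fun p h1 h2 => h p h1 (by omega), h q (by simp [hqdef]) (by simp [hqdef])⟩
      · rintro ⟨h1, h2⟩ p h3 h4
        rcases Nat.lt_or_ge p (t + b) with h5 | h5
        · exact h1 p h3 h5
        · have : p = q := Fin.ext (by simp [hqdef]; omega)
          rw [this]; exact h2
    rw [heq, pow_succ]
    refine step.trans ?_
    have := ih (by omega)
    nlinarith

/-- A finite set with at least `K` elements has `K` elements that are the best for a score. -/
theorem exists_top_subset {α : Type} [DecidableEq α] (F : Finset α) (g : α → ℝ) {K : ℕ}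
    (h : K ≤ F.card) : ∃ D ⊆ F, D.card = K ∧ ∀ x ∈ D, ∀ y ∈ F, g x < g y → y ∈ D := by
  induction K with
  | zero => exact ⟨∅, by simp, rfl, by simp⟩
  | succ K ih =>
    obtain ⟨D, h1, h2, h3⟩ := ih (by omega)
    have hne : (F \ D).Nonempty := by
      rw [← Finset.card_pos, Finset.card_sdiff_of_subset h1]
      omega
    obtain ⟨z, hz, hz'⟩ := Finset.exists_max_image (F \ D) g hne
    rw [Finset.mem_sdiff] at hz
    refine ⟨insert z D, Finset.insert_subset hz.1 h1, ?_, ?_⟩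
    · rw [Finset.card_insert_of_notMem hz.2, h2]
    · intro x hx y hy hxy
      rw [Finset.mem_insert] at hx ⊢
      rcases hx with rfl | hx
      · by_cases hyD : y ∈ D
        · exact Or.inr hyD
        · have := hz' y (Finset.mem_sdiff.2 ⟨hy, hyD⟩)
          linarith
      · exact Or.inr (h3 x hx y hy hxy)

open Equiv in
/-- The event that after a window at least `K` candidates are better than every candidate in the
window has probability at most `exp(-K b / n)`. The candidates and their score are determined before
the window. -/
theorem card_window_bad_le (t b K : ℕ) (htb : t + b ≤ n)
    (F : Perm (Fin n) → Finset (Fin n)) (g : Perm (Fin n) → Fin n → ℝ)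
    (hF : ∀ p p' : Fin n, t ≤ p → t ≤ p' → ∀ π, F (π * swap p p') = F π)
    (hg : ∀ p p' : Fin n, t ≤ p → t ≤ p' → ∀ π, g (π * swap p p') = g π)
    (hlate : ∀ π, ∀ p : Fin n, π p ∈ F π → t ≤ p) (Bad : Perm (Fin n) → Prop) [DecidablePred Bad]
    (hBad : ∀ π, Bad π → ∃ G ⊆ F π, K ≤ G.card ∧ ∀ y ∈ G, ∀ p : Fin n, t ≤ p → (p : ℕ) < t + b →
      π p ∈ F π → g π (π p) < g π y) :
    ((Finset.univ.filter Bad).card : ℝ) ≤ Real.exp (-(K * b / n)) * (n.factorial : ℝ) := by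
  classical
  have hch : ∀ (X : Finset (Fin n)) (s : Fin n → ℝ), ∃ D : Finset (Fin n), K ≤ X.card →
      (D ⊆ X ∧ D.card = K ∧ ∀ x ∈ D, ∀ y ∈ X, s x < s y → y ∈ D) := by
    intro X s
    by_cases h : K ≤ X.card
    · obtain ⟨D, h1, h2, h3⟩ := exists_top_subset X s h
      exact ⟨D, fun _ => ⟨h1, h2, h3⟩⟩
    · exact ⟨∅, fun h' => absurd h' h⟩
  -- The K best candidates are chosen as a function of the candidate set and the score alone, so the
  -- choice inherits their invariance under swaps of later positions.
  choose T hT using hch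
  -- For K > n the event is empty; otherwise 1 - K/n ≥ 0, as needed to take powers.
  rcases Nat.lt_or_ge n K with hKn | hKn
  · have : Finset.univ.filter Bad = ∅ := by
      apply Finset.filter_eq_empty_iff.2
      intro π _ hπ
      obtain ⟨G, -, h, -⟩ := hBad π hπ
      have := Finset.card_le_univ G
      simp at this
      omega
    rw [this, Finset.card_empty, Nat.cast_zero]
    positivity
  have hKn' : (K : ℝ) / n ≤ 1 :=
    div_le_one_of_le₀ (by exact_mod_cast hKn) (Nat.cast_nonneg _)
  set E : Finset (Perm (Fin n)) := Finset.univ.filter fun π => K ≤ (F π).card with hE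
  have key := card_window_miss_le t b K htb E (fun π => T (F π) (g π)) ?_ ?_ ?_ ?_
  · have hEle : (E.card : ℝ) ≤ n.factorial := by
      have := Finset.card_le_univ E
      rw [Fintype.card_perm, Fintype.card_fin] at this
      exact_mod_cast this
    have hpos : (1 - (K : ℝ) / n) ^ b ≤ Real.exp (-(K * b / n)) := by
      have h1 : 1 - (K : ℝ) / n ≤ Real.exp (-(K / n)) := by
        have := Real.add_one_le_exp (-((K : ℝ) / n))
        linarith
      refine (pow_le_pow_left₀ (by linarith) h1 b).trans (le_of_eq ?_)
      rw [← Real.exp_nat_mul]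
      congr 1
      ring
    refine le_trans ?_ (key.trans (mul_le_mul hpos hEle (Nat.cast_nonneg _) (Real.exp_pos _).le))
    rw [Nat.cast_le]
    apply Finset.card_le_card
    intro π hπ
    obtain ⟨G, hG1, hG2, hG3⟩ := hBad π (Finset.mem_filter.1 hπ).2
    have hKF : K ≤ (F π).card := hG2.trans (Finset.card_le_card hG1)
    obtain ⟨t1, t2, t3⟩ := hT (F π) (g π) hKF
    rw [Finset.mem_filter]
    refine ⟨Finset.mem_filter.2 ⟨Finset.mem_univ _, hKF⟩, ?_⟩
    intro p hp1 hp2 hpT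
    -- Were some top candidate in the window, everything in G would beat it, so G would lie in the
    -- top K without that candidate: too few places.
    have hsub : G ⊆ (T (F π) (g π)).erase (π p) := by
      intro y hy
      have hlt := hG3 y hy p hp1 hp2 (t1 hpT)
      rw [Finset.mem_erase]
      refine ⟨?_, t3 _ hpT y (hG1 hy) hlt⟩
      rintro rfl
      exact lt_irrefl _ hlt
    have := Finset.card_le_card hsub
    rw [Finset.card_erase_of_mem hpT, t2] at this
    have := Finset.card_pos.2 ⟨_, hpT⟩
    omega
  · intro p p' hp hp' π hπ
    rw [hE, Finset.mem_filter] at hπ ⊢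
    rw [hF p p' hp hp']
    exact ⟨Finset.mem_univ _, hπ.2⟩
  · intro p p' hp hp' π
    simp only [hF p p' hp hp', hg p p' hp hp']
  · intro π hπ
    exact (hT _ _ (Finset.mem_filter.1 hπ).2).2.1
  · intro π hπ p hp
    exact hlate π p ((hT _ _ (Finset.mem_filter.1 hπ).2).1 hp)

-- Composing with a swap of values shows that all elements are equally likely at position p.
open Equiv in
theorem mul_card_apply_eq (p e : Fin n) :
    n * (Finset.univ.filter fun π : Perm (Fin n) => π p = e).card = n.factorial := by
  have h1 : ∀ e' ∈ (Finset.univ : Finset (Fin n)),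
      (Finset.univ.filter fun π : Perm (Fin n) => π p = e').card =
        (Finset.univ.filter fun π : Perm (Fin n) => π p = e).card := by
    intro e' _
    refine Finset.card_bij' (fun π _ => swap e e' * π) (fun π _ => swap e e' * π) ?_ ?_ ?_ ?_
    · intro π hπ
      simp only [Finset.mem_filter, Finset.mem_univ, true_and] at hπ
      simp [hπ]
    · intro π hπ
      simp only [Finset.mem_filter, Finset.mem_univ, true_and] at hπ
      simp [hπ]
    · intro π _; simp [← mul_assoc]
    · intro π _; simp [← mul_assoc]
  have h2 := Finset.card_eq_sum_card_fiberwise (f := fun π : Perm (Fin n) => π p)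
    (s := Finset.univ) (t := Finset.univ) (by simp)
  rw [Finset.sum_congr rfl h1, Finset.sum_const, Finset.card_univ, Finset.card_univ,
    Fintype.card_perm, Fintype.card_fin, smul_eq_mul] at h2
  exact h2.symm

open Equiv in
/-- The number of arrival orders in which `e` is among the first `q` elements. -/
theorem card_early (q : ℕ) (hq : q ≤ n) (e : Fin n) :
    ((Finset.univ.filter fun π : Perm (Fin n) => (π.symm e : ℕ) < q).card : ℝ) =
      (q : ℝ) / n * n.factorial := by
  have hn : (0 : ℝ) < n := by exact_mod_cast Fin.pos e
  have h1 : (Finset.univ.filter fun π : Perm (Fin n) => (π.symm e : ℕ) < q).card =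
      ∑ p ∈ Finset.univ.filter (fun p : Fin n => (p : ℕ) < q),
        (Finset.univ.filter fun π : Perm (Fin n) => π p = e).card := by
    rw [Finset.card_eq_sum_card_fiberwise (f := fun π : Perm (Fin n) => π.symm e)
      (t := Finset.univ.filter (fun p : Fin n => (p : ℕ) < q)) (fun π hπ => by simpa using hπ)]
    apply Finset.sum_congr rfl
    intro p hp
    congr 1
    ext π
    simp only [Finset.mem_filter, Finset.mem_univ, true_and] at hp ⊢
    rw [Equiv.symm_apply_eq, eq_comm (a := e)]
    constructor
    · exact fun h => h.2
    · intro h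
      refine ⟨?_, h⟩
      rw [← h]; simpa using hp
  have h2 : ∀ p : Fin n, ((Finset.univ.filter fun π : Perm (Fin n) => π p = e).card : ℝ) =
      n.factorial / n := by
    intro p
    rw [eq_div_iff hn.ne', mul_comm]
    exact_mod_cast mul_card_apply_eq p e
  have h3 : (Finset.univ.filter (fun p : Fin n => (p : ℕ) < q)).card = q := by
    rw [Fin.card_filter_val_lt, min_eq_right hq]
  rw [h1, Nat.cast_sum, Finset.sum_congr rfl fun p _ => h2 p, Finset.sum_const, h3, nsmul_eq_mul]
  ring

end

/-! ### The run of the algorithm -/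

namespace GreedyFiltering

section
variable {α : Type} [DecidableEq α] {n r : ℕ} {ε : ℝ} {O : Oracle α}

/-- The length of the first phase. -/
noncomputable def warmup (n : ℕ) (ε : ℝ) : ℕ := ⌈ε * (n : ℝ)⌉₊

/-- The length of a window of the second phase. -/
noncomputable def windowLength (n r : ℕ) (ε : ℝ) : ℕ := ⌈ε * (n : ℝ) / (r : ℝ)⌉₊

/-! ### The set T and the best singleton. -/

theorem top_runState (l : List α) : (runState n r ε O l).top = l.foldl (updateTop ε O) [] := by
  induction l using List.reverseRecOn with
  | nil => rfl
  | append_singleton l e ih => rw [runState_append_singleton, top_step, ih]; simp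

theorem pairwise_orderedInsert {v : α → ℝ} [DecidableRel fun x y => v y < v x] (e : α)
    {l : List α} (h : l.Pairwise fun x y => v y ≤ v x) :
    (l.orderedInsert (fun x y => v y < v x) e).Pairwise fun x y => v y ≤ v x := by
  induction l with
  | nil => simp
  | cons y l ih =>
    rw [List.pairwise_cons] at h
    rw [List.orderedInsert]
    split_ifs with hy
    · rw [List.pairwise_cons]
      refine ⟨?_, List.pairwise_cons.2 h⟩
      intro z hz
      rcases List.mem_cons.1 hz with rfl | hz
      · exact hy.le
      · exact (h.1 z hz).trans hy.le
    · rw [List.pairwise_cons]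
      refine ⟨?_, ih h.2⟩
      intro z hz
      rcases (List.mem_orderedInsert _).1 hz with rfl | hz
      · exact not_lt.1 hy
      · exact h.1 z hz

/-- The clause `best` is the purpose: a feasible element can be absent only from a full list all of
whose members are at least as valuable. -/
structure TopInvariant (ε : ℝ) (O : Oracle α) (l top : List α) : Prop where
  nodup : top.Nodup
  subset : top ⊆ l
  sorted : top.Pairwise fun x y => O.value {y} ≤ O.value {x}
  best : ∀ x ∈ l, O.indep {x} → x ∉ top → top.length = capacity ε ∧
    ∀ y ∈ top, O.value {x} ≤ O.value {y}
  indep : ∀ x ∈ top, O.indep {x}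

theorem topInvariant (l : List α) (hl : l.Nodup) :
    TopInvariant ε O l (l.foldl (updateTop ε O) []) := by
  classical
  induction l using List.reverseRecOn with
  | nil => exact ⟨by simp, by simp, by simp, by simp, by simp⟩
  | append_singleton l e ih =>
    rw [List.foldl_append, List.foldl_cons, List.foldl_nil]
    have hel : e ∉ l := by
      intro h
      rw [List.nodup_append] at hl
      exact hl.2.2 e h e (by simp) rfl
    obtain ⟨i1, i2, i3, i4, i5⟩ := ih (List.nodup_append.1 hl).1
    generalize l.foldl (updateTop ε O) [] = top at *
    by_cases he : O.indep {e}
    · have hperm := List.perm_orderedInsert (fun x y => O.value {y} < O.value {x}) e top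
      have hs := pairwise_orderedInsert (v := fun x => O.value {x}) e i3
      have eU : updateTop ε O top e =
          (top.orderedInsert (fun x y => O.value {y} < O.value {x}) e).take (capacity ε) := by
        unfold updateTop
        rw [if_pos he]
      have hlen := List.orderedInsert_length (fun x y => O.value {y} < O.value {x}) top e
      rw [eU]
      generalize top.orderedInsert (fun x y => O.value {y} < O.value {x}) e = U at *
      have hmem : ∀ x, x ∈ U ↔ x = e ∨ x ∈ top := fun x => by rw [hperm.mem_iff]; simp
      have hnd : U.Nodup := hperm.nodup_iff.2 (List.nodup_cons.2 ⟨fun h => hel (i2 h), i1⟩)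
      have hsplit : U.take (capacity ε) ++ U.drop (capacity ε) = U := List.take_append_drop _ _
      have hs' := hs
      rw [← hsplit, List.pairwise_append] at hs'
      have hout : ∀ x ∈ U, x ∉ U.take (capacity ε) → (U.take (capacity ε)).length = capacity ε ∧
          ∀ y ∈ U.take (capacity ε), O.value {x} ≤ O.value {y} := by
        intro x hx hxt
        have hxd : x ∈ U.drop (capacity ε) := by
          rw [← hsplit, List.mem_append] at hx
          tauto
        have := List.length_pos_of_mem hxd
        rw [List.length_drop] at this
        refine ⟨by rw [List.length_take]; omega, fun y hy => hs'.2.2 y hy x hxd⟩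
      refine ⟨hnd.sublist (List.take_sublist _ _), ?_, hs'.1, ?_, ?_⟩
      · intro x hx
        rcases (hmem x).1 (List.mem_of_mem_take hx) with rfl | h
        · simp
        · simp [i2 h]
      · intro x hx hxi hxt
        by_cases hxU : x ∈ U
        · exact hout x hxU hxt
        · rw [hmem] at hxU
          push Not at hxU
          have hxl : x ∈ l := by
            rw [List.mem_append, List.mem_singleton] at hx
            tauto
          obtain ⟨h1, h2⟩ := i4 x hxl hxi hxU.2
          refine ⟨by rw [List.length_take]; omega, ?_⟩
          intro y hy
          rcases (hmem y).1 (List.mem_of_mem_take hy) with rfl | h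
          -- The comparison of a formerly discarded x with the new element: the list was already
          -- full, so some old z is pushed out now, and z lies between the two in value.
          · have hpos : 0 < (U.drop (capacity ε)).length := by rw [List.length_drop]; omega
            obtain ⟨z, hz⟩ := List.exists_mem_of_length_pos hpos
            have hzU : z ∈ U := List.mem_of_mem_drop hz
            have hzy : z ≠ y := by
              rintro rfl
              rw [← hsplit, List.nodup_append] at hnd
              exact hnd.2.2 z hy z hz rfl
            have hzt : z ∈ top := by have := (hmem z).1 hzU; tauto
            exact (h2 z hzt).trans (hs'.2.2 y hy z hz)
          · exact h2 y h
      · intro x hx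
        rcases (hmem x).1 (List.mem_of_mem_take hx) with rfl | h
        · exact he
        · exact i5 x h
    · have eU : updateTop ε O top e = top := by
        unfold updateTop
        rw [if_neg he]
      rw [eU]
      refine ⟨i1, fun x hx => by simp [i2 hx], i3, ?_, i5⟩
      intro x hx hxi hxt
      rw [List.mem_append, List.mem_singleton] at hx
      rcases hx with hx | rfl
      · exact i4 x hx hxi hxt
      · exact absurd hxi he

/-- If at most `capacity ε` elements have value above `B`, they are all in `T`. -/
theorem mem_top_of_lt {l : List α} (hl : l.Nodup) {B : ℝ} (G : Finset α)
    (hG : ∀ x ∈ l, O.indep {x} → B < O.value {x} → x ∈ G) (hcard : G.card ≤ capacity ε) {x : α}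
    (hx : x ∈ l) (hxi : O.indep {x}) (hxB : B < O.value {x}) : x ∈ (runState n r ε O l).top := by
  rw [top_runState]
  obtain ⟨i1, i2, i3, i4, i5⟩ := topInvariant (ε := ε) (O := O) l hl
  by_contra hxt
  obtain ⟨h1, h2⟩ := i4 x hx hxi hxt
  generalize l.foldl (updateTop ε O) [] = top at *
  have hsub : insert x top.toFinset ⊆ G := by
    intro y hy
    rw [Finset.mem_insert, List.mem_toFinset] at hy
    rcases hy with rfl | hy
    · exact hG y hx hxi hxB
    · exact hG y (i2 hy) (i5 y hy) (hxB.trans_le (h2 y hy))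
  have := Finset.card_le_card hsub
  rw [Finset.card_insert_of_notMem (by simpa using hxt), List.toFinset_card_of_nodup i1] at this
  omega

theorem foldl_updateBest (l : List α) :
    (∀ x ∈ l, O.indep {x} → ∃ y ∈ l.foldl (updateBest O) none, O.value {x} ≤ O.value {y}) ∧
      ∀ y ∈ l.foldl (updateBest O) none, y ∈ l ∧ O.indep {y} := by
  induction l using List.reverseRecOn with
  | nil => simp
  | append_singleton l e ih =>
    rw [List.foldl_append, List.foldl_cons, List.foldl_nil]
    generalize l.foldl (updateBest O) none = c at *
    unfold updateBest
    split_ifs with h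
    · refine ⟨?_, ?_⟩
      · intro x hx hxi
        refine ⟨e, rfl, ?_⟩
        rw [List.mem_append, List.mem_singleton] at hx
        rcases hx with hx | rfl
        · obtain ⟨y, hy, hxy⟩ := ih.1 x hx hxi
          exact hxy.trans (h.2 y hy).le
        · exact le_rfl
      · intro y hy
        rw [Option.mem_def, Option.some.injEq] at hy
        subst hy
        exact ⟨by simp, h.1⟩
    · refine ⟨?_, fun y hy => ⟨by simp [(ih.2 y hy).1], (ih.2 y hy).2⟩⟩
      intro x hx hxi
      rw [List.mem_append, List.mem_singleton] at hx
      rcases hx with hx | rfl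
      · exact ih.1 x hx hxi
      · push Not at h
        exact h hxi

/-! ### The state through the first two phases. -/

theorem runState_warmup (l : List α) (hl : l.length ≤ warmup n ε) :
    (runState n r ε O l).sel = [] ∧ (runState n r ε O l).cand = none ∧
      (runState n r ε O l).filt = [] ∧
      (runState n r ε O l).best = l.foldl (updateBest O) none := by
  induction l using List.reverseRecOn with
  | nil => simp [runState]
  | append_singleton l e ih =>
    rw [List.length_append, List.length_singleton] at hl
    have hc := clock_runState n r ε O l
    obtain ⟨h1, h2, h3, h4⟩ := ih (by omega)
    rw [runState_append_singleton, List.foldl_append, ← h4]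
    generalize runState n r ε O l = σ at *
    have hlt : σ.clock < ⌈ε * (n : ℝ)⌉₊ := by rw [hc]; exact hl
    unfold step
    simp only
    rw [if_pos hlt]
    exact ⟨h1, h2, h3, rfl⟩

/-- Here j is the position inside window i, and the divisibility test on the clock succeeds exactly
at the last position. -/
theorem step_window {σ : State α} {e : α} {i j : ℕ} (hi : i < r)
    (hσ : σ.clock = warmup n ε + i * windowLength n r ε + j) (hj : j < windowLength n r ε) :
    (step n r ε O σ e).best = σ.best ∧ (step n r ε O σ e).filt = σ.filt ∧
      (step n r ε O σ e).sel = (if j + 1 = windowLength n r ε then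
        σ.sel ++ [updateCand O σ.sel σ.cand e] else σ.sel) ∧
      (step n r ε O σ e).cand = (if j + 1 = windowLength n r ε then
        (σ.sel ++ [updateCand O σ.sel σ.cand e]).head?.join else updateCand O σ.sel σ.cand e) := by
  set a := warmup n ε with ha
  set b := windowLength n r ε with hb
  have h1 : ¬ σ.clock < a := by omega
  have h2 : σ.clock < a + r * b := by
    have : (i + 1) * b ≤ r * b := Nat.mul_le_mul_right _ hi
    rw [add_mul, one_mul] at this
    omega
  have h3 : (σ.clock + 1 - a) % b = 0 ↔ j + 1 = b := by
    have : σ.clock + 1 - a = (j + 1) + b * i := by rw [hσ, mul_comm b i]; omega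
    rw [this, Nat.add_mul_mod_self_left]
    constructor
    · intro h
      by_contra hne
      rw [Nat.mod_eq_of_lt (by omega)] at h
      omega
    · intro h
      rw [h, Nat.mod_self]
  unfold step
  simp only [show ⌈ε * (n : ℝ)⌉₊ = a from rfl, show ⌈ε * (n : ℝ) / (r : ℝ)⌉₊ = b from rfl]
  rw [if_neg h1, if_pos h2]
  by_cases h4 : j + 1 = b
  · rw [if_pos (h3.2 h4)]
    simp [h4]
  · rw [if_neg (mt h3.1 h4)]
    simp [h4]

theorem foldl_step_window {i : ℕ} (hi : i < r) (w : List α) :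
    ∀ (j : ℕ) (σ : State α), σ.clock = warmup n ε + i * windowLength n r ε + j →
      j + w.length < windowLength n r ε →
      (w.foldl (step n r ε O) σ).best = σ.best ∧ (w.foldl (step n r ε O) σ).filt = σ.filt ∧
      (w.foldl (step n r ε O) σ).sel = σ.sel ∧
      (w.foldl (step n r ε O) σ).cand = w.foldl (updateCand O σ.sel) σ.cand ∧
      (w.foldl (step n r ε O) σ).clock = σ.clock + w.length := by
  induction w with
  | nil => intro j σ _ _; simp
  | cons e w ih =>
    intro j σ hσ hj
    rw [List.length_cons] at hj
    obtain ⟨h1, h2, h3, h4⟩ := step_window (O := O) (e := e) hi hσ (by omega)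
    rw [if_neg (by omega)] at h3 h4
    have h5 := clock_step n r ε O σ e
    obtain ⟨k1, k2, k3, k4, k5⟩ := ih (j + 1) (step n r ε O σ e) (by omega) (by omega)
    rw [List.foldl_cons, List.foldl_cons, k1, k2, k3, k4, k5, h1, h2, h3, h4, h5, List.length_cons]
    refine ⟨rfl, rfl, rfl, rfl, by omega⟩

theorem foldl_step_full_window {i : ℕ} (hi : i < r) (w : List α) (σ : State α)
    (hσ : σ.clock = warmup n ε + i * windowLength n r ε) (hw : w.length = windowLength n r ε)
    (hb : 0 < windowLength n r ε) :
      (w.foldl (step n r ε O) σ).best = σ.best ∧ (w.foldl (step n r ε O) σ).filt = σ.filt ∧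
      (w.foldl (step n r ε O) σ).sel = σ.sel ++ [w.foldl (updateCand O σ.sel) σ.cand] ∧
      (w.foldl (step n r ε O) σ).cand =
        (σ.sel ++ [w.foldl (updateCand O σ.sel) σ.cand]).head?.join := by
  rcases List.eq_nil_or_concat w with rfl | ⟨w', e, rfl⟩
  · simp at hw; omega
  rw [List.concat_eq_append] at hw ⊢
  rw [List.length_append, List.length_singleton] at hw
  obtain ⟨k1, k2, k3, k4, k5⟩ := foldl_step_window (O := O) hi w' 0 σ hσ (by omega)
  rw [List.foldl_append, List.foldl_append, List.foldl_cons, List.foldl_cons, List.foldl_nil,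
    List.foldl_nil]
  obtain ⟨h1, h2, h3, h4⟩ := step_window (O := O) (e := e) (σ := w'.foldl (step n r ε O) σ)
    (n := n) (ε := ε) (j := w'.length) hi (by omega) (by omega)
  rw [if_pos (by omega), k3, k4] at h3 h4
  rw [h1, h2, h3, h4, k1, k2]
  exact ⟨rfl, rfl, rfl, rfl⟩

/-- The last clause supports the second one: in the first window an element replaces the dummy
whatever its gain, which is harmless because no earlier element of the window was feasible. -/
theorem foldl_updateCand (sel : List (Option α)) (c₀ : Option α) (w : List α) :
    (w.foldl (updateCand O sel) c₀ = c₀ ∨ ∃ x ∈ w, w.foldl (updateCand O sel) c₀ = some x ∧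
      O.indep (insert x (selSet sel))) ∧
    (∀ x ∈ w, O.indep (insert x (selSet sel)) →
      gain O (selSet sel) (some x) ≤ gain O (selSet sel) (w.foldl (updateCand O sel) c₀)) ∧
    (sel ≠ [] → gain O (selSet sel) c₀ ≤ gain O (selSet sel) (w.foldl (updateCand O sel) c₀)) ∧
    (sel = [] → w.foldl (updateCand O sel) c₀ = none →
      ∀ x ∈ w, ¬ O.indep (insert x (selSet sel))) := by
  induction w using List.reverseRecOn with
  | nil => simp
  | append_singleton w e ih =>
    rw [List.foldl_append, List.foldl_cons, List.foldl_nil]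
    obtain ⟨i1, i2, i3, i4⟩ := ih
    generalize w.foldl (updateCand O sel) c₀ = c at *
    unfold updateCand
    split_ifs with h
    · refine ⟨Or.inr ⟨e, by simp, rfl, h.1⟩, ?_, ?_, by simp⟩
      · intro x hx hxi
        rw [List.mem_append, List.mem_singleton] at hx
        rcases hx with hx | rfl
        · rcases h.2 with ⟨h2, h3⟩ | h2
          · exact absurd hxi (i4 h2 h3 x hx)
          · exact (i2 x hx hxi).trans h2.le
        · exact le_rfl
      · intro hs
        rcases h.2 with ⟨h2, -⟩ | h2
        · exact absurd h2 hs
        · exact (i3 hs).trans h2.le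
    · refine ⟨?_, ?_, i3, ?_⟩
      · rcases i1 with h1 | ⟨x, hx, h1⟩
        · exact Or.inl h1
        · exact Or.inr ⟨x, by simp [hx], h1⟩
      · intro x hx hxi
        rw [List.mem_append, List.mem_singleton] at hx
        rcases hx with hx | rfl
        · exact i2 x hx hxi
        · by_contra hlt
          exact h ⟨hxi, Or.inr (not_le.1 hlt)⟩
      · intro hs hc x hx hxi
        rw [List.mem_append, List.mem_singleton] at hx
        rcases hx with hx | rfl
        · exact i4 hs hc x hx hxi
        · exact h ⟨hxi, Or.inl ⟨hs, hc⟩⟩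

/-- The state before the window number `i`, counted from zero. -/
noncomputable def stage (n r : ℕ) (ε : ℝ) (O : Oracle α) (l : List α) (i : ℕ) : State α :=
  runState n r ε O (l.take (warmup n ε + i * windowLength n r ε))

/-- The window number `i`, counted from zero. -/
noncomputable def window (n r : ℕ) (ε : ℝ) (l : List α) (i : ℕ) : List α :=
  (l.drop (warmup n ε + i * windowLength n r ε)).take (windowLength n r ε)

/-- The selector chosen in window number `i`. -/
noncomputable def selector (n r : ℕ) (ε : ℝ) (O : Oracle α) (l : List α) (i : ℕ) : Option α :=
  (window n r ε l i).foldl (updateCand O (stage n r ε O l i).sel) (stage n r ε O l i).sel.head?.join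

/-- The set of the first `i` selectors. -/
noncomputable def chain (n r : ℕ) (ε : ℝ) (O : Oracle α) (l : List α) (i : ℕ) : Finset α :=
  selSet (stage n r ε O l i).sel

variable {l : List α}

theorem stage_succ_eq (i : ℕ) : stage n r ε O l (i + 1) =
    (window n r ε l i).foldl (step n r ε O) (stage n r ε O l i) := by
  rw [stage, stage, window, ← runState_append, ← List.take_add, add_mul, one_mul, add_assoc]

/-- With window length zero the second phase would be empty and no selector would be chosen. -/
structure Fits (n r : ℕ) (ε : ℝ) (l : List α) : Prop where
  length_le : warmup n ε + r * windowLength n r ε ≤ l.length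
  pos : 0 < windowLength n r ε

theorem Fits.le (h : Fits n r ε l) {i : ℕ} (hi : i ≤ r) :
    warmup n ε + i * windowLength n r ε ≤ l.length :=
  (Nat.add_le_add_left (Nat.mul_le_mul_right _ hi) _).trans h.length_le

theorem Fits.length_window (h : Fits n r ε l) {i : ℕ} (hi : i < r) :
    (window n r ε l i).length = windowLength n r ε := by
  have := h.le (i := i + 1) hi
  rw [add_mul, one_mul] at this
  rw [window, List.length_take, List.length_drop]
  omega

theorem stage_zero : (stage n r ε O l 0).sel = [] ∧
    (stage n r ε O l 0).cand = none ∧ (stage n r ε O l 0).filt = [] ∧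
    (stage n r ε O l 0).best = (l.take (warmup n ε)).foldl (updateBest O) none := by
  unfold stage
  rw [zero_mul, add_zero]
  exact runState_warmup _ (by simp)

theorem stage_spec (h : Fits n r ε l) {i : ℕ} (hi : i ≤ r) :
    (stage n r ε O l i).sel.length = i ∧
    (stage n r ε O l i).cand = (stage n r ε O l i).sel.head?.join ∧
    (stage n r ε O l i).filt = [] ∧
    (stage n r ε O l i).best = (stage n r ε O l 0).best := by
  induction i with
  | zero =>
    obtain ⟨h1, h2, h3, h4⟩ := stage_zero (n := n) (r := r) (ε := ε) (O := O) (l := l)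
    simp [h1, h2, h3]
  | succ i ih =>
    obtain ⟨h1, h2, h3, h4⟩ := ih (by omega)
    have hclock : (stage n r ε O l i).clock = warmup n ε + i * windowLength n r ε := by
      rw [stage, clock_runState, List.length_take]
      have := h.le (i := i) (by omega)
      omega
    obtain ⟨k1, k2, k3, k4⟩ := foldl_step_full_window (O := O) (i := i) (by omega)
      (window n r ε l i) (stage n r ε O l i) hclock (h.length_window (by omega)) h.pos
    rw [stage_succ_eq, k1, k2, k3, k4]
    exact ⟨by simp [h1], rfl, h3, h4⟩

theorem sel_stage_succ (h : Fits n r ε l) {i : ℕ} (hi : i < r) :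
    (stage n r ε O l (i + 1)).sel = (stage n r ε O l i).sel ++ [selector n r ε O l i] := by
  obtain ⟨h1, h2, h3, h4⟩ := stage_spec (O := O) h hi.le
  have hclock : (stage n r ε O l i).clock = warmup n ε + i * windowLength n r ε := by
    rw [stage, clock_runState, List.length_take]
    have := h.le (i := i) (by omega)
    omega
  obtain ⟨k1, k2, k3, k4⟩ := foldl_step_full_window (O := O) (i := i) (by omega)
    (window n r ε l i) (stage n r ε O l i) hclock (h.length_window (by omega)) h.pos
  rw [stage_succ_eq, k3, h2]
  rfl

theorem sel_stage_take (h : Fits n r ε l) {i j : ℕ} (hij : i ≤ j) (hj : j ≤ r) :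
    (stage n r ε O l j).sel.take i = (stage n r ε O l i).sel := by
  induction j, hij using Nat.le_induction with
  | base =>
    rw [List.take_of_length_le]
    exact (stage_spec h hj).1.le
  | succ j hij ih =>
    rw [sel_stage_succ h hj, List.take_append_of_le_length, ih (by omega)]
    rw [(stage_spec h (by omega)).1]
    exact hij

theorem sel_stage_getElem? (h : Fits n r ε l) {i : ℕ} (hi : i < r) :
    (stage n r ε O l r).sel[i]? = some (selector n r ε O l i) := by
  have h1 := sel_stage_take (O := O) h (i := i + 1) (j := r) hi le_rfl
  have h2 : ((stage n r ε O l r).sel.take (i + 1))[i]? = (stage n r ε O l r).sel[i]? :=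
    List.getElem?_take_of_lt (by omega)
  rw [← h2, h1, sel_stage_succ h hi]
  have h3 := (stage_spec (O := O) h hi.le).1
  rw [List.getElem?_append_right (by omega), h3]
  simp

theorem chain_zero : chain n r ε O l 0 = ∅ := by
  rw [chain, stage_zero.1, selSet_nil]

theorem chain_succ (h : Fits n r ε l) {i : ℕ} (hi : i < r) :
    chain n r ε O l (i + 1) = chain n r ε O l i ∪ (selector n r ε O l i).toFinset := by
  rw [chain, sel_stage_succ h hi, selSet_append_singleton, chain]

theorem gain_selector (h : Fits n r ε l) {i : ℕ} (hi : i < r) :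
    gain O (chain n r ε O l i) (selector n r ε O l i) =
      O.value (chain n r ε O l (i + 1)) - O.value (chain n r ε O l i) := by
  rw [chain_succ h hi, gain]

theorem gain_some (S : Finset α) (x : α) : gain O S (some x) = O.value (insert x S) - O.value S := by
  rw [gain, Option.toFinset_some, Finset.union_comm, Finset.insert_eq]

theorem gain_head (sel : List (Option α)) : gain O (selSet sel) sel.head?.join = 0 := by
  rw [gain, sub_eq_zero]
  congr 1
  rw [Finset.union_eq_left]
  intro x hx
  rw [Option.mem_toFinset, Option.mem_def] at hx
  rw [mem_selSet]
  exact head?_join_mem hx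

/-- From the second window on the initial candidate s₁ has gain zero, so the value of the chain
cannot drop. In the first window it can: the dummy gives way to any feasible element. -/
theorem selector_spec (h : Fits n r ε l) {i : ℕ} (hi : i < r) :
    (chain n r ε O l (i + 1) = chain n r ε O l i ∨ ∃ x ∈ window n r ε l i, x ∉ chain n r ε O l i ∧
      chain n r ε O l (i + 1) = insert x (chain n r ε O l i) ∧
      O.indep (insert x (chain n r ε O l i))) ∧
    (∀ x ∈ window n r ε l i, O.indep (insert x (chain n r ε O l i)) →
      O.value (insert x (chain n r ε O l i)) ≤ O.value (chain n r ε O l (i + 1))) ∧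
    (1 ≤ i → O.value (chain n r ε O l i) ≤ O.value (chain n r ε O l (i + 1))) := by
  obtain ⟨k1, k2, k3, k4⟩ := foldl_updateCand (O := O) (stage n r ε O l i).sel
    (stage n r ε O l i).sel.head?.join (window n r ε l i)
  change (selector n r ε O l i = _ ∨ ∃ x ∈ _, selector n r ε O l i = _ ∧
    O.indep (insert x (chain n r ε O l i))) at k1
  change ∀ x ∈ window n r ε l i, O.indep (insert x (chain n r ε O l i)) →
      gain O (chain n r ε O l i) (some x) ≤ gain O (chain n r ε O l i) (selector n r ε O l i) at k2
  change _ → _ ≤ gain O (chain n r ε O l i) (selector n r ε O l i) at k3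
  rw [gain_head] at k3
  rw [gain_selector h hi] at k2 k3
  refine ⟨?_, ?_, ?_⟩
  · rw [chain_succ h hi]
    rcases k1 with k1 | ⟨x, hx, k1, k5⟩
    · left
      rw [k1, Finset.union_eq_left]
      intro x hx
      rw [Option.mem_toFinset, Option.mem_def] at hx
      rw [chain, mem_selSet]
      exact head?_join_mem hx
    · by_cases hxc : x ∈ chain n r ε O l i
      · left
        rw [k1, Option.toFinset_some, Finset.union_eq_left]
        simpa using hxc
      · right
        refine ⟨x, hx, hxc, ?_, k5⟩
        rw [k1, Option.toFinset_some, Finset.union_comm, Finset.insert_eq]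
  · intro x hx hxi
    have := k2 x hx hxi
    rw [gain_some] at this
    linarith
  · intro h1
    have hne : (stage n r ε O l i).sel ≠ [] := by
      intro hnil
      have := (stage_spec (O := O) h hi.le).1
      rw [hnil] at this
      simp at this
      omega
    linarith [k3 hne]

theorem chain_indep (h : Fits n r ε l) (h0 : O.indep ∅) {i : ℕ} (hi : i ≤ r) :
    O.indep (chain n r ε O l i) := by
  induction i with
  | zero => rw [chain_zero]; exact h0
  | succ i ih =>
    rcases (selector_spec (O := O) h hi).1 with h1 | ⟨x, -, -, h1, h2⟩
    · rw [h1]; exact ih (by omega)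
    · rw [h1]; exact h2

theorem chain_subset (h : Fits n r ε l) {i : ℕ} (hi : i ≤ r) :
    ∀ x ∈ chain n r ε O l i, ∃ j < i, x ∈ window n r ε l j := by
  induction i with
  | zero => rw [chain_zero]; simp
  | succ i ih =>
    intro x hx
    rcases (selector_spec (O := O) h hi).1 with h1 | ⟨y, hy, -, h1, h2⟩
    · rw [h1] at hx
      obtain ⟨j, hj, hxj⟩ := ih (by omega) x hx
      exact ⟨j, by omega, hxj⟩
    · rw [h1, Finset.mem_insert] at hx
      rcases hx with rfl | hx
      · exact ⟨i, by omega, hy⟩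
      · obtain ⟨j, hj, hxj⟩ := ih (by omega) x hx
        exact ⟨j, by omega, hxj⟩

/-- The set `I` in the run on the stream `l`. -/
noncomputable def runLevels (n r : ℕ) (ε : ℝ) (O : Oracle α) (l : List α) : Finset ℝ :=
  levels r ε (bound r ε O (stage n r ε O l 0).best)

-- If all passing elements together stay within the limit, the cut-off never acts and H is exactly
-- the set of passing elements. The levels are constant here, since the best singleton is frozen
-- after the first phase.
open Classical in
theorem final_state (h : Fits n r ε l)
    (hlim : (((l.drop (warmup n ε + r * windowLength n r ε)).filter
      fun e => Passes O (runLevels n r ε O l) (stage n r ε O l r).sel e).length : ℝ) ≤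
      (r : ℝ) * Real.log ((r : ℝ) / ε) * ((runLevels n r ε O l).card : ℝ) / ε) :
    (runState n r ε O l).sel = (stage n r ε O l r).sel ∧
    (runState n r ε O l).filt = (l.drop (warmup n ε + r * windowLength n r ε)).filter
      fun e => Passes O (runLevels n r ε O l) (stage n r ε O l r).sel e := by
  set rest := l.drop (warmup n ε + r * windowLength n r ε) with hrest
  obtain ⟨h1, h2, h3, h4⟩ := stage_spec (O := O) h le_rfl
  have hclock : (stage n r ε O l r).clock = warmup n ε + r * windowLength n r ε := by
    rw [stage, clock_runState, List.length_take]
    have := h.length_le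
    omega
  have hrun : runState n r ε O l = rest.foldl (step n r ε O) (stage n r ε O l r) := by
    rw [stage, ← runState_append, List.take_append_drop]
  rw [hrun]
  suffices hs : (rest.foldl (step n r ε O) (stage n r ε O l r)).sel = (stage n r ε O l r).sel ∧
      (rest.foldl (step n r ε O) (stage n r ε O l r)).filt =
        rest.filter (fun e => Passes O (runLevels n r ε O l) (stage n r ε O l r).sel e) ∧
      (rest.foldl (step n r ε O) (stage n r ε O l r)).best = (stage n r ε O l r).best ∧
      warmup n ε + r * windowLength n r ε ≤
        (rest.foldl (step n r ε O) (stage n r ε O l r)).clock from ⟨hs.1, hs.2.1⟩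
  clear_value rest
  clear hrun hrest
  induction rest using List.reverseRecOn with
  | nil => simp [h3, hclock]
  | append_singleton rest e ih =>
    rw [List.foldl_append, List.foldl_cons, List.foldl_nil]
    rw [List.filter_append, List.length_append, Nat.cast_add] at hlim
    obtain ⟨k1, k2, k3, k4⟩ := ih (by
      have : (0 : ℝ) ≤ ((List.filter (fun e => decide (Passes O (runLevels n r ε O l)
        (stage n r ε O l r).sel e)) [e]).length : ℝ) := Nat.cast_nonneg _
      linarith)
    rw [List.filter_append, ← k2]
    rw [← k2] at hlim
    generalize rest.foldl (step n r ε O) (stage n r ε O l r) = σ at *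
    have c1 : ¬ σ.clock < ⌈ε * (n : ℝ)⌉₊ := by
      have : warmup n ε = ⌈ε * (n : ℝ)⌉₊ := rfl
      omega
    have c2 : ¬ σ.clock < ⌈ε * (n : ℝ)⌉₊ + r * ⌈ε * (n : ℝ) / (r : ℝ)⌉₊ := not_lt.2 k4
    unfold step
    simp only
    rw [if_neg c1, if_neg c2]
    refine ⟨k1, ?_, k3, by simp only; omega⟩
    simp only
    have hI : levels r ε (bound r ε O σ.best) = runLevels n r ε O l := by
      rw [k3, h4]; rfl
    unfold updateFilt
    simp only [hI, k1]
    by_cases hp : Passes O (runLevels n r ε O l) (stage n r ε O l r).sel e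
    · have hle : (σ.filt.length : ℝ) ≤
          (r : ℝ) * Real.log ((r : ℝ) / ε) * ((runLevels n r ε O l).card : ℝ) / ε :=
        le_trans (by simp) hlim
      rw [if_pos ⟨hle, hp⟩]
      simp [hp]
    · rw [if_neg (fun hh => hp hh.2)]
      simp [hp]

end

/-! ### Streams -/

section
variable {n : ℕ}
open OnePassAlgorithm

theorem length_stream (π : Equiv.Perm (Fin n)) : (stream π).length = n := by simp [stream]

theorem nodup_stream (π : Equiv.Perm (Fin n)) : (stream π).Nodup :=
  List.nodup_ofFn.2 π.injective

theorem mem_stream (π : Equiv.Perm (Fin n)) (x : Fin n) : x ∈ stream π := by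
  rw [stream, List.mem_ofFn]
  exact ⟨π.symm x, by simp⟩

theorem mem_drop_stream {π : Equiv.Perm (Fin n)} {t : ℕ} {x : Fin n} :
    x ∈ (stream π).drop t ↔ t ≤ (π.symm x : ℕ) := by
  rw [List.mem_iff_getElem]
  constructor
  · rintro ⟨i, hi, rfl⟩
    simp [stream]
  · intro h
    have := (π.symm x).2
    refine ⟨(π.symm x : ℕ) - t, by rw [List.length_drop, length_stream]; omega, ?_⟩
    rw [List.getElem_drop]
    simp [stream, Nat.add_sub_cancel' h]

theorem mem_take_stream {π : Equiv.Perm (Fin n)} {t : ℕ} {x : Fin n} :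
    x ∈ (stream π).take t ↔ (π.symm x : ℕ) < t := by
  rw [List.mem_iff_getElem]
  constructor
  · rintro ⟨i, hi, rfl⟩
    rw [List.length_take] at hi
    simp [stream]
    omega
  · intro h
    have := (π.symm x).2
    refine ⟨(π.symm x : ℕ), by rw [List.length_take, length_stream]; omega, ?_⟩
    rw [List.getElem_take]
    simp [stream]

theorem mem_take_drop_stream {π : Equiv.Perm (Fin n)} {t b : ℕ} {x : Fin n} :
    x ∈ ((stream π).drop t).take b ↔ t ≤ (π.symm x : ℕ) ∧ (π.symm x : ℕ) < t + b := by
  rw [List.mem_iff_getElem]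
  constructor
  · rintro ⟨i, hi, rfl⟩
    rw [List.length_take] at hi
    simp [stream]
    omega
  · rintro ⟨h, h'⟩
    have := (π.symm x).2
    refine ⟨(π.symm x : ℕ) - t, by
      rw [List.length_take, List.length_drop, length_stream]; omega, ?_⟩
    rw [List.getElem_take, List.getElem_drop]
    simp [stream, Nat.add_sub_cancel' h]

/-- The source of all conditioning: what is computed from the first t elements is invariant under
swaps of later positions. -/
theorem take_stream_swap {π : Equiv.Perm (Fin n)} {t : ℕ} {p p' : Fin n} (hp : t ≤ p)
    (hp' : t ≤ p') : (stream (π * Equiv.swap p p')).take t = (stream π).take t := by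
  apply List.ext_getElem
  · simp [length_stream]
  · intro i h1 h2
    rw [List.length_take] at h1
    rw [List.getElem_take, List.getElem_take]
    simp only [stream, List.getElem_ofFn, Equiv.Perm.mul_apply]
    rw [Equiv.swap_apply_of_ne_of_ne]
    · intro hh; rw [← hh] at hp; simp at hp; omega
    · intro hh; rw [← hh] at hp'; simp at hp'; omega

end

end GreedyFiltering

/-! ### Rounding -/

namespace GreedyFiltering

theorem roundDown_mem {I : Finset ℝ} (hI : I.Nonempty) (x : ℝ) : roundDown I x ∈ I := by
  unfold roundDown
  split_ifs with h
  · exact (Finset.mem_filter.1 (Finset.max'_mem _ h)).1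
  · exact Finset.min'_mem _ _

theorem roundDown_mono (I : Finset ℝ) : Monotone (roundDown I) := by
  intro x y hxy
  have hsub : I.filter (· ≤ x) ⊆ I.filter (· ≤ y) := by
    intro z hz
    rw [Finset.mem_filter] at hz ⊢
    exact ⟨hz.1, hz.2.trans hxy⟩
  by_cases hx : (I.filter (· ≤ x)).Nonempty
  · have hy := hx.mono hsub
    rw [roundDown, roundDown, dif_pos hx, dif_pos hy]
    exact Finset.max'_subset hx hsub
  · by_cases hI : I.Nonempty
    · rw [roundDown, dif_neg hx, dif_pos hI]
      exact Finset.min'_le _ _ (roundDown_mem hI y)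
    · rw [Finset.not_nonempty_iff_eq_empty] at hI
      subst hI
      simp [roundDown]

theorem levels_nonempty (r : ℕ) (ε w : ℝ) : (levels r ε w).Nonempty :=
  Finset.Nonempty.image (by simp) _

/-- If the rounded value of `x` is at most that of `y`, then `x` is not much larger than `y`. -/
theorem le_of_roundDown_le {r : ℕ} {ε B x y : ℝ} (hr : 1 ≤ r) (hε : 0 < ε) (hε' : ε < 1 / 2)
    (hB : 0 ≤ B) (hx : x ≤ B)
    (h : roundDown (levels r ε (B * ((r : ℝ) / ε))) x ≤
      roundDown (levels r ε (B * ((r : ℝ) / ε))) y) :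
    x ≤ (1 + ε) * (max y 0 + ε * B / r) := by
  have hr' : (1 : ℝ) ≤ r := by exact_mod_cast hr
  set m : ℝ := ε * B / r with hm
  have hm0 : 0 ≤ m := by positivity
  have hy0 := le_max_right y 0
  have hyy := le_max_left y 0
  -- For small x the additive error m alone suffices; m is also the lowest level.
  by_cases hxm : x ≤ (1 + ε) * m
  · nlinarith
  push Not at hxm
  have hBpos : 0 < B := by nlinarith
  have hmpos : 0 < m := by positivity
  have hbase : ε ^ 2 * (B * ((r : ℝ) / ε)) / (r : ℝ) ^ 2 = m := by
    rw [hm]; field_simp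
  set J := ⌈2 * Real.logb (1 + ε) ((r : ℝ) / ε)⌉₊ with hJ
  set I := levels r ε (B * ((r : ℝ) / ε)) with hI
  have hmem : ∀ z, z ∈ I ↔ ∃ j ≤ J, (1 + ε) ^ j * m = z := by
    intro z
    rw [hI, levels, hbase]
    simp [← hJ]
  -- The levels span a factor (r/ε)², and (r/ε)² m = (r/ε) B, so the highest level is at least B and
  -- hence at least x.
  have htop : B ≤ (1 + ε) ^ J * m := by
    have h1 : ((r : ℝ) / ε) ^ 2 ≤ (1 + ε) ^ J := by
      have h2 : 2 * Real.logb (1 + ε) ((r : ℝ) / ε) ≤ J := Nat.le_ceil _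
      have h3 : ((r : ℝ) / ε) ^ 2 = (1 + ε) ^ (2 * Real.logb (1 + ε) ((r : ℝ) / ε)) := by
        rw [mul_comm, Real.rpow_mul (by linarith), Real.rpow_logb (by linarith) (by linarith)
          (by positivity)]
        norm_num
      rw [h3, ← Real.rpow_natCast]
      exact Real.rpow_le_rpow_of_exponent_le (by linarith) h2
    have h4 : B ≤ ((r : ℝ) / ε) ^ 2 * m := by
      have h5 : ((r : ℝ) / ε) ^ 2 * m = r / ε * B := by rw [hm]; field_simp
      rw [h5]
      have h6 : 1 ≤ (r : ℝ) / ε := by rw [le_div_iff₀ hε]; linarith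
      nlinarith
    exact h4.trans (mul_le_mul_of_nonneg_right h1 hm0)
  have hmI : m ∈ I := (hmem m).2 ⟨0, Nat.zero_le _, by simp⟩
  have hne : (I.filter (· ≤ x)).Nonempty := ⟨m, Finset.mem_filter.2 ⟨hmI, by nlinarith⟩⟩
  have hrx : roundDown I x = (I.filter (· ≤ x)).max' hne := by rw [roundDown, dif_pos hne]
  have hzI := roundDown_mem ⟨m, hmI⟩ x
  obtain ⟨j, hj, hz⟩ := (hmem _).1 hzI
  -- Below the highest level, the next level would otherwise also be at most x; at the highest level
  -- x ≤ B applies.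
  have hxz : x ≤ (1 + ε) * roundDown I x := by
    rcases hj.lt_or_eq with hj | rfl
    · by_contra hlt
      push Not at hlt
      have h1 : (1 + ε) ^ (j + 1) * m ∈ I.filter (· ≤ x) := by
        rw [Finset.mem_filter]
        refine ⟨(hmem _).2 ⟨j + 1, hj, rfl⟩, ?_⟩
        rw [← hz] at hlt
        rw [pow_succ]
        nlinarith
      have h2 := Finset.le_max' _ _ h1
      rw [← hrx, ← hz, pow_succ] at h2
      have h3 : 0 < (1 + ε) ^ j * m := by positivity
      nlinarith
    · rw [hz] at htop
      nlinarith
  by_cases hney : (I.filter (· ≤ y)).Nonempty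
  · have hry : roundDown I y ≤ y := by
      rw [roundDown, dif_pos hney]
      exact (Finset.mem_filter.1 (Finset.max'_mem _ hney)).2
    nlinarith
  -- A y below all levels, possibly negative, is rounded up to m; this is what the additive error
  -- pays for.
  · have hry : roundDown I y ≤ m := by
      rw [roundDown, dif_neg hney, dif_pos ⟨m, hmI⟩]
      exact Finset.min'_le _ _ hmI
    nlinarith

open Classical in
/-- The number of elements that pass the filter, if at every stage at most `K` elements beat the
selector: every rounded value contributes at most `K` elements. -/
theorem card_passing_le {α : Type} {R : Finset α} {I : Finset ℝ} {r K : ℕ}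
    {feas : ℕ → α → Prop} {u : ℕ → ℝ} {v : ℕ → α → ℝ} {rd : ℝ → ℝ} (hrd : Monotone rd)
    (hI : ∀ x, rd x ∈ I)
    (hanti : ∀ i < r, ∀ j ≤ i, ∀ e ∈ R, feas i e → feas j e ∧ v i e ≤ v j e)
    (hK : ∀ i < r, (R.filter fun e => feas i e ∧ u i < v i e).card ≤ K) :
    (R.filter fun e => ∃ i < r, feas i e ∧ rd (u i) < rd (v i e)).card ≤ I.card * K := by
  have hsub : (R.filter fun e => ∃ i < r, feas i e ∧ rd (u i) < rd (v i e)) ⊆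
      I.biUnion fun z => R.filter fun e => ∃ i < r, feas i e ∧ rd (u i) < z ∧ rd (v i e) = z := by
    intro e he
    rw [Finset.mem_filter] at he
    obtain ⟨heR, i, hi, h1, h2⟩ := he
    rw [Finset.mem_biUnion]
    exact ⟨_, hI (v i e), Finset.mem_filter.2 ⟨heR, i, hi, h1, h2, rfl⟩⟩
  refine (Finset.card_le_card hsub).trans (Finset.card_biUnion_le_card_mul _ _ _ fun z _ => ?_)
  -- Fix a level z and take the first stage whose selector is rounded below z. An element that
  -- passes at level z does so at this stage or later; by decreasing marginals it was feasible here
  -- and beat this selector, so at most K elements qualify.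
  by_cases hex : ∃ i < r, rd (u i) < z
  · obtain ⟨h1, h2⟩ := Nat.find_spec hex
    refine (Finset.card_le_card ?_).trans (hK _ h1)
    intro e he
    rw [Finset.mem_filter] at he ⊢
    obtain ⟨heR, i, hi, h3, h4, h5⟩ := he
    obtain ⟨h6, h7⟩ := hanti i hi (Nat.find hex) (Nat.find_min' hex ⟨hi, h4⟩) e heR h3
    refine ⟨heR, h6, ?_⟩
    by_contra hlt
    have := hrd (not_lt.1 hlt)
    have := hrd h7
    linarith
  · rw [Finset.filter_eq_empty_iff.2]
    · simp
    · rintro e - ⟨i, hi, -, h4, -⟩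
      exact hex ⟨i, hi, h4⟩

/-! ### The returned set -/

section
variable {α : Type} [DecidableEq α] {O : Oracle α}

theorem bestSubset_spec (h0 : O.indep ∅) (B : Finset α) :
    O.indep (bestSubset O B) ∧ ∀ X ⊆ B, O.indep X → O.value X ≤ O.value (bestSubset O B) := by
  classical
  have hex : ∃ X ⊆ B, O.indep X ∧ ∀ Y ⊆ B, O.indep Y → O.value Y ≤ O.value X := by
    obtain ⟨X, hX, hX'⟩ := Finset.exists_max_image (B.powerset.filter O.indep) O.value
      ⟨∅, by simp [h0]⟩
    rw [Finset.mem_filter, Finset.mem_powerset] at hX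
    refine ⟨X, hX.1, hX.2, fun Y hY hYi => hX' Y ?_⟩
    rw [Finset.mem_filter, Finset.mem_powerset]
    exact ⟨hY, hYi⟩
  have he : bestSubset O B = hex.choose := by rw [bestSubset, dif_pos hex]
  rw [he]
  exact ⟨hex.choose_spec.2.1, hex.choose_spec.2.2⟩

end

/-! ### One arrival order -/

section
variable {n r : ℕ} {ε : ℝ} {f : Finset (Fin n) → ℝ} {M : Matroid (Fin n)}
open OnePassAlgorithm

theorem empty_indep (f : Finset (Fin n) → ℝ) (M : Matroid (Fin n)) : (Oracle.of f M).indep ∅ := by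
  change M.Indep ((∅ : Finset (Fin n)) : Set (Fin n))
  simp

theorem result_eq (O : Oracle (Fin n)) (π : Equiv.Perm (Fin n)) :
    (greedyFiltering n r ε).result O π = output O (runState n r ε O (stream π)) := rfl

theorem result_indep (π : Equiv.Perm (Fin n)) :
    M.Indep ((greedyFiltering n r ε).result (Oracle.of f M) π : Set (Fin n)) :=
  (bestSubset_spec (empty_indep f M) _).1

theorem passes_iff {O : Oracle (Fin n)} {l : List (Fin n)} (h : Fits n r ε l) (I : Finset ℝ)
    (e : Fin n) : Passes O I (stage n r ε O l r).sel e ↔ ∃ i < r,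
      O.indep (insert e (chain n r ε O l i)) ∧
      roundDown I (O.value (chain n r ε O l (i + 1)) - O.value (chain n r ε O l i)) <
      roundDown I (O.value (insert e (chain n r ε O l i)) - O.value (chain n r ε O l i)) := by
  unfold Passes
  constructor
  · rintro ⟨i, s, hs, h1, h2⟩
    have hi : i < r := by
      have := (List.getElem?_eq_some_iff.1 hs).1
      rwa [(stage_spec h le_rfl).1] at this
    rw [sel_stage_getElem? h hi, Option.some.injEq] at hs
    subst hs
    rw [sel_stage_take h hi.le le_rfl] at h1 h2
    change roundDown I (gain O (chain n r ε O l i) _) <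
      roundDown I (gain O (chain n r ε O l i) _) at h2
    rw [gain_selector h hi, gain_some] at h2
    exact ⟨i, hi, h1, h2⟩
  · rintro ⟨i, hi, h1, h2⟩
    refine ⟨i, _, sel_stage_getElem? h hi, ?_⟩
    rw [sel_stage_take h hi.le le_rfl]
    refine ⟨h1, ?_⟩
    change roundDown I (gain O (chain n r ε O l i) _) <
      roundDown I (gain O (chain n r ε O l i) _)
    rw [gain_selector h hi, gain_some]
    exact h2

/-- The best singleton value of the first phase. -/
noncomputable def warmupValue (n r : ℕ) (ε : ℝ) (O : Oracle (Fin n)) (l : List (Fin n)) : ℝ :=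
  (stage n r ε O l 0).best.elim 0 fun e => O.value {e}

open Classical in
/-- The elements that are better than everything in the first phase. -/
noncomputable def aboveWarmup (n r : ℕ) (ε : ℝ) (O : Oracle (Fin n)) (l : List (Fin n)) :
    Finset (Fin n) :=
  Finset.univ.filter fun x => O.indep {x} ∧ warmupValue n r ε O l < O.value {x}

open Classical in
/-- The elements of the third phase that are better than the selector number `i`. -/
noncomputable def aboveSelector (n r : ℕ) (ε : ℝ) (O : Oracle (Fin n)) (l : List (Fin n)) (i : ℕ) :
    Finset (Fin n) :=
  (l.drop (warmup n ε + r * windowLength n r ε)).toFinset.filter fun x =>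
    O.indep (insert x (chain n r ε O l i)) ∧
      O.value (chain n r ε O l (i + 1)) - O.value (chain n r ε O l i) <
        O.value (insert x (chain n r ε O l i)) - O.value (chain n r ε O l i)

/-- A threshold for the number of elements better than a selector. -/
noncomputable def threshold (r : ℕ) (ε : ℝ) : ℕ := ⌈(r : ℝ) / ε * Real.log ((r : ℝ) / ε)⌉₊

/-- A sample phase misses too many of the best candidates. -/
def Unlucky (n r : ℕ) (ε : ℝ) (O : Oracle (Fin n)) (l : List (Fin n)) : Prop :=
  capacity ε ≤ (aboveWarmup n r ε O l).card ∨
    ∃ i < r, threshold r ε ≤ (aboveSelector n r ε O l i).card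

theorem chain_early {O : Oracle (Fin n)} {π : Equiv.Perm (Fin n)} (h : Fits n r ε (stream π))
    {x : Fin n} {i : ℕ} (hi : i ≤ r) (hx : x ∈ chain n r ε O (stream π) i) :
    warmup n ε ≤ (π.symm x : ℕ) ∧ (π.symm x : ℕ) < warmup n ε + i * windowLength n r ε := by
  obtain ⟨j, hj, hxj⟩ := chain_subset h hi x hx
  rw [window, mem_take_drop_stream] at hxj
  have : (j + 1) * windowLength n r ε ≤ i * windowLength n r ε := Nat.mul_le_mul_right _ hj
  rw [add_mul, one_mul] at this
  omega

theorem chain_mono {O : Oracle (Fin n)} {l : List (Fin n)} (h : Fits n r ε l) {i j : ℕ}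
    (hij : i ≤ j) (hj : j ≤ r) : chain n r ε O l i ⊆ chain n r ε O l j := by
  rw [chain, chain, ← sel_stage_take h hij hj]
  exact selSet_mono (List.take_subset _ _)

-- In a lucky order fewer than `threshold r ε` late elements beat any given selector, so each level
-- contributes at most `threshold r ε - 1`, which is at most (r/ε) ln(r/ε) because the threshold is
-- the ceiling. Summing over the levels gives exactly the limit of the filter.
open Classical in
theorem filter_passes_length_le (hinst : IsInstance n r f M) (hε : 0 < ε) (hε' : ε < 1 / 2)
    {π : Equiv.Perm (Fin n)} (h : Fits n r ε (stream π))
    (hgood : ¬ Unlucky n r ε (Oracle.of f M) (stream π)) :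
    ((((stream π).drop (warmup n ε + r * windowLength n r ε)).filter
      fun e => Passes (Oracle.of f M) (runLevels n r ε (Oracle.of f M) (stream π))
        (stage n r ε (Oracle.of f M) (stream π) r).sel e).length : ℝ) ≤
      (r : ℝ) * Real.log ((r : ℝ) / ε) *
        ((runLevels n r ε (Oracle.of f M) (stream π)).card : ℝ) / ε := by
  set O := Oracle.of f M with hO
  set l := stream π with hl
  set I := runLevels n r ε O l with hI
  have hnd : (l.drop (warmup n ε + r * windowLength n r ε)).Nodup :=
    (nodup_stream π).sublist (List.drop_sublist _ _)
  unfold Unlucky at hgood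
  push Not at hgood
  have hlog := log_two_le_log_div hinst.rank_pos hε hε'
  have hr : (1 : ℝ) ≤ r := by exact_mod_cast hinst.rank_pos
  have hx0 : 0 ≤ (r : ℝ) / ε * Real.log ((r : ℝ) / ε) := by positivity
  have hcount := card_passing_le (R := (l.drop (warmup n ε + r * windowLength n r ε)).toFinset)
    (I := I) (r := r) (K := threshold r ε - 1)
    (feas := fun i e => O.indep (insert e (chain n r ε O l i)))
    (u := fun i => O.value (chain n r ε O l (i + 1)) - O.value (chain n r ε O l i))
    (v := fun i e => O.value (insert e (chain n r ε O l i)) - O.value (chain n r ε O l i))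
    (roundDown_mono I) (fun x => roundDown_mem (levels_nonempty _ _ _) x) (by
      intro i hi j hj e he hfe
      rw [List.mem_toFinset, mem_drop_stream] at he
      have hsub := chain_mono (O := O) h hj hi.le
      refine ⟨?_, ?_⟩
      · exact Matroid.Indep.subset hfe (by exact_mod_cast Finset.insert_subset_insert e hsub)
      · apply hinst.submodular.insert_sub_le hsub
        intro hmem
        have := (chain_early h hi.le hmem).2
        have : i * windowLength n r ε ≤ r * windowLength n r ε := Nat.mul_le_mul_right _ hi.le
        omega) (by
      intro i hi
      have := hgood.2 i hi
      unfold aboveSelector at this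
      exact Nat.le_sub_one_of_lt this)
  have hlen : ((l.drop (warmup n ε + r * windowLength n r ε)).filter
      fun e => Passes O I (stage n r ε O l r).sel e).length ≤ I.card * (threshold r ε - 1) := by
    refine le_trans (le_of_eq ?_) hcount
    rw [← List.toFinset_card_of_nodup (hnd.filter _), List.toFinset_filter]
    congr 1
    apply Finset.filter_congr
    intro e _
    rw [decide_eq_true_iff, passes_iff h]
  have hth : ((threshold r ε - 1 : ℕ) : ℝ) ≤ (r : ℝ) / ε * Real.log ((r : ℝ) / ε) := by
    have h1 := Nat.ceil_lt_add_one hx0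
    change (threshold r ε : ℝ) < _ at h1
    rcases Nat.eq_zero_or_pos (threshold r ε) with h2 | h2
    · rw [h2]; simpa using hx0
    · rw [Nat.cast_sub h2]
      push_cast
      linarith
  calc _ ≤ ((I.card * (threshold r ε - 1) : ℕ) : ℝ) := by exact_mod_cast hlen
    _ = I.card * ((threshold r ε - 1 : ℕ) : ℝ) := by push_cast; rfl
    _ ≤ I.card * ((r : ℝ) / ε * Real.log ((r : ℝ) / ε)) := by gcongr
    _ = _ := by ring

theorem warmupValue_nonneg (h0 : ∀ X, 0 ≤ f X) (l : List (Fin n)) :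
    0 ≤ warmupValue n r ε (Oracle.of f M) l := by
  unfold warmupValue
  cases (stage n r ε (Oracle.of f M) l 0).best with
  | none => exact le_rfl
  | some x => exact h0 _

theorem warmupValue_spec {O : Oracle (Fin n)} {l : List (Fin n)} {x : Fin n}
    (hx : x ∈ l.take (warmup n ε)) (hxi : O.indep {x}) :
    O.value {x} ≤ warmupValue n r ε O l := by
  obtain ⟨y, hy, hxy⟩ := (foldl_updateBest (O := O) (l.take (warmup n ε))).1 x hx hxi
  have hb := (stage_zero (n := n) (r := r) (ε := ε) (O := O) (l := l)).2.2.2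
  rw [← hb, Option.mem_def] at hy
  rw [warmupValue, hy]
  exact hxy

theorem warmupValue_le (h0 : ∀ X, 0 ≤ f X) {Opt : Finset (Fin n)}
    (hmax : ∀ X : Finset (Fin n), M.Indep (X : Set (Fin n)) → f X ≤ f Opt) (l : List (Fin n)) :
    warmupValue n r ε (Oracle.of f M) l ≤ f Opt := by
  have hb := (stage_zero (n := n) (r := r) (ε := ε) (O := Oracle.of f M) (l := l)).2.2.2
  have h1 := (foldl_updateBest (O := Oracle.of f M) (l.take (warmup n ε))).2
  rw [← hb] at h1
  unfold warmupValue
  cases hbest : (stage n r ε (Oracle.of f M) l 0).best with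
  | none => exact h0 _
  | some x => exact hmax _ (h1 x hbest).2

/-- The elements of `X` that arrive after the sample phases. -/
def latePart (q : ℕ) (X : Finset (Fin n)) (π : Equiv.Perm (Fin n)) : Finset (Fin n) :=
  X.filter fun x => q ≤ (π.symm x : ℕ)

/-- `exists_hybrid` is applied to the late part of the optimum, with P the elements in T or H and L
the rest. Both P ∪ A and the chain S_r lie in T ∪ S_r ∪ H, so the output is at least as good as
each: this is the factor 2. -/
theorem value_le_of_lucky (hinst : IsInstance n r f M) (hε : 0 < ε) (hε' : ε < 1 / 2)
    {π : Equiv.Perm (Fin n)} (h : Fits n r ε (stream π))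
    (hgood : ¬ Unlucky n r ε (Oracle.of f M) (stream π)) {Opt : Finset (Fin n)}
    (hOpt : M.Indep (Opt : Set (Fin n)))
    (hmax : ∀ X : Finset (Fin n), M.Indep (X : Set (Fin n)) → f X ≤ f Opt) :
    f (latePart (warmup n ε + r * windowLength n r ε) Opt π ∪
        chain n r ε (Oracle.of f M) (stream π) r) ≤
      2 * f ((greedyFiltering n r ε).result (Oracle.of f M) π) + 3 * ε * f Opt := by
  classical
  obtain ⟨hsel, hfilt⟩ := final_state h (filter_passes_length_le hinst hε hε' h hgood)
  have hres : ∀ X ⊆ (runState n r ε (Oracle.of f M) (stream π)).top.toFinset ∪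
      chain n r ε (Oracle.of f M) (stream π) r ∪
      (runState n r ε (Oracle.of f M) (stream π)).filt.toFinset, M.Indep (X : Set (Fin n)) →
      f X ≤ f ((greedyFiltering n r ε).result (Oracle.of f M) π) := by
    intro X hX hXi
    rw [result_eq]
    refine (bestSubset_spec (empty_indep f M) _).2 X ?_ hXi
    rw [hsel]
    exact hX
  have hwarm := warmupValue_nonneg (r := r) (ε := ε) (M := M) hinst.nonneg (stream π)
  have hwarm' := warmupValue_le (r := r) (ε := ε) hinst.nonneg hmax (stream π)
  have hci := chain_indep h (empty_indep f M) (le_refl r)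
  have hfit : ∀ {i}, i ≤ r → ∀ x ∈ chain n r ε (Oracle.of f M) (stream π) i,
      (π.symm x : ℕ) < warmup n ε + i * windowLength n r ε :=
    fun hi x hx => (chain_early h hi hx).2
  have hspec := fun i (hi : i < r) => selector_spec (O := Oracle.of f M) h hi
  have hpass := fun (I : Finset ℝ) (e : Fin n) => passes_iff (O := Oracle.of f M) h I e
  have hzero := chain_zero (n := n) (r := r) (ε := ε) (O := Oracle.of f M) (l := stream π)
  have hIeq : runLevels n r ε (Oracle.of f M) (stream π) =
      levels r ε (warmupValue n r ε (Oracle.of f M) (stream π) * ((r : ℝ) / ε)) := rfl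
  rw [hIeq] at hfilt
  have htop : ∀ x, M.Indep ({x} : Set (Fin n)) →
      warmupValue n r ε (Oracle.of f M) (stream π) < f {x} →
      x ∈ (runState n r ε (Oracle.of f M) (stream π)).top := by
    intro x hxi hx
    refine mem_top_of_lt (nodup_stream π) (aboveWarmup n r ε (Oracle.of f M) (stream π)) ?_ ?_
      (mem_stream π x) (by simpa [Oracle.of] using hxi) hx
    · intro y _ h1 h2
      exact Finset.mem_filter.2 ⟨Finset.mem_univ _, h1, h2⟩
    · unfold Unlucky at hgood
      push Not at hgood
      exact hgood.1.le
  generalize warmupValue n r ε (Oracle.of f M) (stream π) = B at *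
  generalize (runState n r ε (Oracle.of f M) (stream π)).top = top at *
  generalize hfl : (runState n r ε (Oracle.of f M) (stream π)).filt = filt at *
  generalize f ((greedyFiltering n r ε).result (Oracle.of f M) π) = alg at *
  set S := chain n r ε (Oracle.of f M) (stream π) with hS
  set q := warmup n ε + r * windowLength n r ε with hq
  set O' := latePart q Opt π with hO'
  have hO'sub : O' ⊆ Opt := Finset.filter_subset _ _
  have hPL : O'.filter (fun x => x ∈ top ∨ x ∈ filt) ∪
      O'.filter (fun x => ¬ (x ∈ top ∨ x ∈ filt)) = O' := Finset.filter_union_filter_not_eq _ _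
  have hr1 : (1 : ℝ) ≤ r := by exact_mod_cast hinst.rank_pos
  have hO'i : M.Indep (O' : Set (Fin n)) := hOpt.subset (by exact_mod_cast hO'sub)
  obtain ⟨A, hA1, hA2, hA3⟩ := exists_hybrid (M := M)
    (P := O'.filter (fun x => x ∈ top ∨ x ∈ filt))
    (L := O'.filter (fun x => ¬ (x ∈ top ∨ x ∈ filt))) (S := S) (r := r) (ε := ε)
    (m := ε * B / r) hinst.submodular hinst.nonneg hinst.ground hε.le (by positivity)
    (by rw [hPL]; exact hO'i) (Finset.disjoint_filter_filter_not _ _ _)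
    (by
      rw [hPL]
      have := hO'i.encard_le_eRank
      rw [hinst.rank, Set.encard_coe_eq_coe_finsetCard] at this
      exact_mod_cast this)
    hzero hci
    (by
      intro i hi
      rcases (hspec i hi).1 with h1 | ⟨x, -, h1, h2, -⟩
      · exact Or.inl h1
      · exact Or.inr ⟨x, h1, h2⟩)
    (by
      rw [hPL, Finset.disjoint_left]
      intro x hx hxS
      have h1 := hfit le_rfl x hxS
      have h2 := (Finset.mem_filter.1 hx).2
      omega)
    (fun i hi h1 => (hspec i hi).2.2 h1)
    (by
      intro o ho i hi hoi
      rw [Finset.mem_filter] at ho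
      obtain ⟨hoO, ho'⟩ := ho
      push Not at ho'
      have hopos := (Finset.mem_filter.1 hoO).2
      have hosing : M.Indep ({o} : Set (Fin n)) := hoi.subset (by simp)
      -- Not being in T bounds the singleton value, hence every marginal, by B; not being in H means
      -- failing the filter at stage i.
      have hoB : f (insert o (S i)) - f (S i) ≤ B := by
        refine (hinst.submodular.insert_le_singleton hinst.nonneg).trans ?_
        by_contra hlt
        exact ho'.1 (htop o hosing (not_le.1 hlt))
      apply le_of_roundDown_le hinst.rank_pos hε hε' hwarm hoB
      by_contra hlt
      apply ho'.2
      rw [hfilt, List.mem_filter, decide_eq_true_iff, hpass]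
      exact ⟨mem_drop_stream.2 hopos, i, hi, hoi, not_le.1 hlt⟩)
  rw [hPL] at hA3
  have h1 : f (O'.filter (fun x => x ∈ top ∨ x ∈ filt) ∪ A) ≤ alg := by
    apply hres _ _ hA2
    intro x hx
    simp only [Finset.mem_union, Finset.mem_filter, List.mem_toFinset] at hx ⊢
    rcases hx with ⟨-, hx | hx⟩ | hx
    · tauto
    · tauto
    · have := hA1 hx; tauto
  have h2 : f (S r) ≤ alg := by
    apply hres _ _ hci
    intro x hx
    simp only [Finset.mem_union]
    tauto
  have h3 : f A ≤ f Opt := hmax _ (Matroid.Indep.subset hA2 (by simp))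
  have h4 : (r : ℝ) * (ε * B / r) = ε * B := by field_simp
  rw [h4] at hA3
  have h5 : 0 ≤ f A := hinst.nonneg A
  -- The error is ε f(A) + (1 + ε) ε B with f(A) and B at most f(Opt), so at most (2 + ε) ε f(Opt).
  nlinarith [mul_le_mul_of_nonneg_left h3 hε.le, mul_le_mul_of_nonneg_left hwarm' hε.le,
    mul_nonneg hε.le hwarm]

/-- A crude bound for unlucky orders: the late part of the optimum and the chain are both
independent, and f is subadditive. -/
theorem value_le (hinst : IsInstance n r f M) {π : Equiv.Perm (Fin n)} (h : Fits n r ε (stream π))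
    {Opt : Finset (Fin n)} (hOpt : M.Indep (Opt : Set (Fin n)))
    (hmax : ∀ X : Finset (Fin n), M.Indep (X : Set (Fin n)) → f X ≤ f Opt) :
    f (latePart (warmup n ε + r * windowLength n r ε) Opt π ∪
        chain n r ε (Oracle.of f M) (stream π) r) ≤ 2 * f Opt := by
  have h1 := hinst.submodular (latePart (warmup n ε + r * windowLength n r ε) Opt π)
    (chain n r ε (Oracle.of f M) (stream π) r)
  have h2 := hmax (latePart (warmup n ε + r * windowLength n r ε) Opt π)
    (hOpt.subset (by exact_mod_cast Finset.filter_subset _ _))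
  have h3 := hmax _ (chain_indep h (empty_indep f M) (le_refl r))
  have h4 := hinst.nonneg (latePart (warmup n ε + r * windowLength n r ε) Opt π ∩
    chain n r ε (Oracle.of f M) (stream π) r)
  linarith

end

/-! ### Random arrival order -/

section
variable {n r : ℕ} {ε : ℝ} {f : Finset (Fin n) → ℝ} {M : Matroid (Fin n)}
open OnePassAlgorithm

-- The first phase is a window starting at time 0, with all non-loops as candidates. The product of
-- `capacity ε` and its length is at least n ln(1/ε).
open Classical in
theorem card_aboveWarmup_le (hn : 0 < n) (hε : 0 < ε) (hwarm : warmup n ε ≤ n)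
    (O : Oracle (Fin n)) :
    ((Finset.univ.filter fun π : Equiv.Perm (Fin n) =>
      capacity ε ≤ (aboveWarmup n r ε O (stream π)).card).card : ℝ) ≤ ε * n.factorial := by
  have hn' : (0 : ℝ) < n := by exact_mod_cast hn
  refine (card_window_bad_le 0 (warmup n ε) (capacity ε) (by omega)
    (fun _ => Finset.univ.filter fun x => O.indep {x}) (fun _ x => O.value {x})
    (fun _ _ _ _ _ => rfl) (fun _ _ _ _ _ => rfl) (fun _ _ _ => Nat.zero_le _) _ ?_).trans ?_
  · intro π hπ
    refine ⟨aboveWarmup n r ε O (stream π), ?_, hπ, ?_⟩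
    · intro x hx
      have := (Finset.mem_filter.1 hx).2
      simp [this.1]
    · intro y hy p _ hp hpi
      have h1 := (Finset.mem_filter.1 hy).2.2
      refine lt_of_le_of_lt (warmupValue_spec ?_ (Finset.mem_filter.1 hpi).2) h1
      rw [mem_take_stream]
      simpa using hp
  · refine mul_le_mul_of_nonneg_right ?_ (Nat.cast_nonneg _)
    have h1 : Real.log (1 / ε) / ε ≤ capacity ε := Nat.le_ceil _
    have h2 : ε * n ≤ warmup n ε := Nat.le_ceil _
    have h3 : Real.log (1 / ε) ≤ capacity ε * warmup n ε / n := by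
      rw [le_div_iff₀ hn']
      calc Real.log (1 / ε) * n = Real.log (1 / ε) / ε * (ε * n) := by field_simp
        _ ≤ capacity ε * (ε * n) := by gcongr
        _ ≤ capacity ε * warmup n ε := by gcongr
    calc Real.exp (-(capacity ε * warmup n ε / n)) ≤ Real.exp (-Real.log (1 / ε)) :=
          Real.exp_le_exp.2 (neg_le_neg h3)
      _ = ε := by rw [← Real.log_inv, Real.exp_log (by positivity)]; simp

theorem stage_swap (O : Oracle (Fin n)) {i : ℕ} {p p' : Fin n}
    (hp : warmup n ε + i * windowLength n r ε ≤ p)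
    (hp' : warmup n ε + i * windowLength n r ε ≤ p') (π : Equiv.Perm (Fin n)) :
    stage n r ε O (stream (π * Equiv.swap p p')) i = stage n r ε O (stream π) i := by
  rw [stage, stage, take_stream_swap hp hp']

theorem le_symm_swap {t : ℕ} {p p' : Fin n} (hp : t ≤ p) (hp' : t ≤ p') (π : Equiv.Perm (Fin n))
    (x : Fin n) : t ≤ ((π * Equiv.swap p p').symm x : ℕ) ↔ t ≤ (π.symm x : ℕ) := by
  rw [← not_lt, ← not_lt, ← mem_take_stream, ← mem_take_stream, take_stream_swap hp hp']

-- The candidates are the feasible elements arriving from the start of window i on, scored by their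
-- marginal over the chain so far; both depend only on the past. Threshold times window length is at
-- least n ln(r/ε), so the failure probability ε/r survives a union bound over the r windows.
open Classical in
theorem card_aboveSelector_le (hn : 0 < n) (hr : 1 ≤ r) (hε : 0 < ε) (hε' : ε < 1 / 2)
    (hfit : ∀ π : Equiv.Perm (Fin n), Fits n r ε (stream π)) (O : Oracle (Fin n)) {i : ℕ}
    (hi : i < r) :
    ((Finset.univ.filter fun π : Equiv.Perm (Fin n) =>
      threshold r ε ≤ (aboveSelector n r ε O (stream π) i).card).card : ℝ) ≤
      ε / r * n.factorial := by
  have hn' : (0 : ℝ) < n := by exact_mod_cast hn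
  have hr' : (1 : ℝ) ≤ r := by exact_mod_cast hr
  have hfits := hfit 1
  have hle := hfits.le (i := i + 1) hi
  rw [length_stream, add_mul, one_mul, ← add_assoc] at hle
  have hmul : (i + 1) * windowLength n r ε ≤ r * windowLength n r ε := Nat.mul_le_mul_right _ hi
  rw [add_mul, one_mul] at hmul
  refine (card_window_bad_le (warmup n ε + i * windowLength n r ε) (windowLength n r ε)
    (threshold r ε) hle
    (fun π => Finset.univ.filter fun x => warmup n ε + i * windowLength n r ε ≤ (π.symm x : ℕ) ∧
      O.indep (insert x (chain n r ε O (stream π) i)))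
    (fun π x => O.value (insert x (chain n r ε O (stream π) i)) -
      O.value (chain n r ε O (stream π) i)) ?_ ?_ ?_ _ ?_).trans ?_
  · intro p p' hp hp' π
    refine Finset.filter_congr fun x _ => ?_
    simp only [chain, stage_swap O hp hp', le_symm_swap hp hp']
  · intro p p' hp hp' π
    simp only [chain, stage_swap O hp hp']
  · intro π p hp
    simpa using (Finset.mem_filter.1 hp).2.1
  · intro π hπ
    refine ⟨aboveSelector n r ε O (stream π) i, ?_, hπ, ?_⟩
    · intro x hx
      obtain ⟨h1, h2, -⟩ := Finset.mem_filter.1 hx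
      rw [List.mem_toFinset, mem_drop_stream] at h1
      exact Finset.mem_filter.2 ⟨Finset.mem_univ _, by omega, h2⟩
    · intro y hy p hp1 hp2 hpF
      refine lt_of_le_of_lt ?_ (Finset.mem_filter.1 hy).2.2
      have := (selector_spec (O := O) (hfit π) hi).2.1 (π p) (by
        rw [window, mem_take_drop_stream]
        simpa using ⟨hp1, hp2⟩) (Finset.mem_filter.1 hpF).2.2
      linarith
  · refine mul_le_mul_of_nonneg_right ?_ (Nat.cast_nonneg _)
    have hlog := log_two_le_log_div hr hε hε'
    have h1 : (r : ℝ) / ε * Real.log ((r : ℝ) / ε) ≤ threshold r ε := Nat.le_ceil _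
    have h2 : ε * n / r ≤ windowLength n r ε := Nat.le_ceil _
    have h3 : Real.log ((r : ℝ) / ε) ≤ threshold r ε * windowLength n r ε / n := by
      rw [le_div_iff₀ hn']
      calc Real.log ((r : ℝ) / ε) * n =
            (r : ℝ) / ε * Real.log ((r : ℝ) / ε) * (ε * n / r) := by field_simp
        _ ≤ threshold r ε * (ε * n / r) := by gcongr
        _ ≤ threshold r ε * windowLength n r ε := by gcongr
    calc Real.exp (-(threshold r ε * windowLength n r ε / n)) ≤
          Real.exp (-Real.log ((r : ℝ) / ε)) := Real.exp_le_exp.2 (neg_le_neg h3)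
      _ = ε / r := by rw [← Real.log_inv, Real.exp_log (by positivity)]; simp

open Classical in
theorem card_unlucky_le (hn : 0 < n) (hr : 1 ≤ r) (hε : 0 < ε) (hε' : ε < 1 / 2)
    (hfit : ∀ π : Equiv.Perm (Fin n), Fits n r ε (stream π)) (O : Oracle (Fin n)) :
    ((Finset.univ.filter fun π : Equiv.Perm (Fin n) => Unlucky n r ε O (stream π)).card : ℝ) ≤
      2 * ε * n.factorial := by
  have hr' : (1 : ℝ) ≤ r := by exact_mod_cast hr
  have hwarm : warmup n ε ≤ n := by
    have := (hfit 1).length_le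
    rw [length_stream] at this
    omega
  have hsub : (Finset.univ.filter fun π : Equiv.Perm (Fin n) => Unlucky n r ε O (stream π)) ⊆
      (Finset.univ.filter fun π : Equiv.Perm (Fin n) =>
        capacity ε ≤ (aboveWarmup n r ε O (stream π)).card) ∪
      (Finset.range r).biUnion fun i => Finset.univ.filter fun π : Equiv.Perm (Fin n) =>
        threshold r ε ≤ (aboveSelector n r ε O (stream π) i).card := by
    intro π hπ
    rw [Finset.mem_union, Finset.mem_biUnion]
    rcases (Finset.mem_filter.1 hπ).2 with h | ⟨i, hi, h⟩
    · exact Or.inl (Finset.mem_filter.2 ⟨Finset.mem_univ _, h⟩)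
    · exact Or.inr ⟨i, Finset.mem_range.2 hi, Finset.mem_filter.2 ⟨Finset.mem_univ _, h⟩⟩
  have h1 := ((Finset.card_le_card hsub).trans (Finset.card_union_le _ _)).trans
    (Nat.add_le_add_left Finset.card_biUnion_le _)
  have h2 := card_aboveWarmup_le (r := r) hn hε hwarm O
  have h3 : ((∑ i ∈ Finset.range r, (Finset.univ.filter fun π : Equiv.Perm (Fin n) =>
        threshold r ε ≤ (aboveSelector n r ε O (stream π) i).card).card : ℕ) : ℝ) ≤
      ε * n.factorial := by
    rw [Nat.cast_sum]
    refine (Finset.sum_le_sum fun i hi => card_aboveSelector_le hn hr hε hε' hfit O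
      (Finset.mem_range.1 hi)).trans (le_of_eq ?_)
    rw [Finset.sum_const, Finset.card_range, nsmul_eq_mul]
    field_simp
  have h4 : ((Finset.univ.filter fun π : Equiv.Perm (Fin n) =>
      Unlucky n r ε O (stream π)).card : ℝ) ≤ _ := Nat.cast_le.2 h1
  rw [Nat.cast_add] at h4
  linarith

/-- Rounding up costs at most 1 in the first phase and 1 per window, so at most 1 + r ≤ 2r in total.
-/
theorem sampleLength_le (hn : 0 < n) (hr : 1 ≤ r) (hε : 0 < ε) :
    ((warmup n ε + r * windowLength n r ε : ℕ) : ℝ) ≤ (2 * ε + 2 * (r : ℝ) / n) * n := by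
  have hn' : (0 : ℝ) < n := by exact_mod_cast hn
  have hr' : (1 : ℝ) ≤ r := by exact_mod_cast hr
  have h1 : (warmup n ε : ℝ) < ε * n + 1 := Nat.ceil_lt_add_one (by positivity)
  have h2 : (windowLength n r ε : ℝ) < ε * n / r + 1 := Nat.ceil_lt_add_one (by positivity)
  have h3 : (r : ℝ) * windowLength n r ε ≤ r * (ε * n / r + 1) := by gcongr
  have h4 : (r : ℝ) * (ε * n / r + 1) = ε * n + r := by field_simp
  have h5 : (2 * ε + 2 * (r : ℝ) / n) * n = 2 * ε * n + 2 * r := by field_simp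
  push_cast
  linarith

/-- With δ = 2ε + 2r/n, averaging gives (1 - 2δ) f(Opt) ≤ 2 E[ALG] + 3ε f(Opt) + 2ε · 2 f(Opt), the
last term from unlucky orders; half of 3ε + 4ε is 7ε/2. -/
theorem expectedValue_ge (hinst : IsInstance n r f M) (hε : 0 < ε) (hε' : ε < 1 / 2)
    (hδ : 2 * ε + 2 * (r : ℝ) / n < 1) {Opt : Finset (Fin n)} (hOpt : M.Indep (Opt : Set (Fin n)))
    (hmax : ∀ X : Finset (Fin n), M.Indep (X : Set (Fin n)) → f X ≤ f Opt) :
    (1 / 2 - (2 * ε + 2 * (r : ℝ) / n) - 7 / 2 * ε) * f Opt ≤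
      (greedyFiltering n r ε).expectedValue (Oracle.of f M) := by
  classical
  have hr := hinst.rank_pos
  have hn : 0 < n := hr.trans (rank_le_of_isInstance hinst)
  have hn' : (0 : ℝ) < n := by exact_mod_cast hn
  have hr' : (1 : ℝ) ≤ r := by exact_mod_cast hr
  have hq := sampleLength_le hn hr hε
  have hqn : warmup n ε + r * windowLength n r ε ≤ n := by
    have : ((warmup n ε + r * windowLength n r ε : ℕ) : ℝ) ≤ n := by nlinarith
    exact_mod_cast this
  have hfit : ∀ π : Equiv.Perm (Fin n), Fits n r ε (stream π) := fun π =>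
    ⟨by rw [length_stream]; exact hqn, Nat.ceil_pos.2 (by positivity)⟩
  set q := warmup n ε + r * windowLength n r ε with hqdef
  have hunl := card_unlucky_le hn hr hε hε' hfit (Oracle.of f M)
  have hN : (0 : ℝ) < n.factorial := by exact_mod_cast n.factorial_pos
  have hsamp := hinst.submodular.sampling_near hinst.nonneg Opt
    (fun π : Equiv.Perm (Fin n) =>
      latePart q Opt π ∪ chain n r ε (Oracle.of f M) (stream π) r)
    (p := (q : ℝ) / n * n.factorial) (by positivity)
    (by
      intro x hx
      rw [← card_early q hqn x, Nat.cast_le]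
      apply Finset.card_le_card
      intro π hπ
      rw [Finset.mem_filter, Finset.mem_union] at hπ
      refine Finset.mem_filter.2 ⟨Finset.mem_univ _, ?_⟩
      rcases hπ.2 with h | h
      · exact absurd (Finset.mem_filter.1 h).1 hx
      · exact (chain_early (hfit π) le_rfl h).2)
    (by
      intro x hx
      rw [← card_early q hqn x, Nat.cast_le]
      apply Finset.card_le_card
      intro π hπ
      rw [Finset.mem_filter, Finset.mem_union] at hπ
      refine Finset.mem_filter.2 ⟨Finset.mem_univ _, ?_⟩
      by_contra hlt
      exact hπ.2 (Or.inl (Finset.mem_filter.2 ⟨hx, not_lt.1 hlt⟩)))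
  rw [Fintype.card_perm, Fintype.card_fin] at hsamp
  have hOpt0 := hinst.nonneg Opt
  have hterm : ∀ π : Equiv.Perm (Fin n),
      f (latePart q Opt π ∪ chain n r ε (Oracle.of f M) (stream π) r) ≤
        (2 * f ((greedyFiltering n r ε).result (Oracle.of f M) π) + 3 * ε * f Opt) +
          if Unlucky n r ε (Oracle.of f M) (stream π) then 2 * f Opt else 0 := by
    intro π
    split_ifs with h
    · have h1 := value_le hinst (hfit π) hOpt hmax
      have h2 := hinst.nonneg ((greedyFiltering n r ε).result (Oracle.of f M) π)
      have h3 : 0 ≤ ε * f Opt := by positivity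
      linarith
    · have := value_le_of_lucky hinst hε hε' (hfit π) h hOpt hmax
      linarith
  have hsum := Finset.sum_le_sum fun π (_ : π ∈ (Finset.univ : Finset (Equiv.Perm (Fin n)))) =>
    hterm π
  rw [Finset.sum_add_distrib, Finset.sum_add_distrib, ← Finset.mul_sum, Finset.sum_const,
    ← Finset.sum_filter, Finset.sum_const, Finset.card_univ, Fintype.card_perm, Fintype.card_fin,
    nsmul_eq_mul, nsmul_eq_mul] at hsum
  have hunl' := mul_le_mul_of_nonneg_right hunl (show 0 ≤ 2 * f Opt by positivity)
  have hqδ : (q : ℝ) / n * n.factorial * f Opt ≤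
      (2 * ε + 2 * (r : ℝ) / n) * n.factorial * f Opt := by
    have : (q : ℝ) / n ≤ 2 * ε + 2 * (r : ℝ) / n := by rwa [div_le_iff₀ hn']
    gcongr
  unfold expectedValue
  rw [Fintype.card_perm, Fintype.card_fin, le_div_iff₀ hN]
  change _ ≤ ∑ π, f ((greedyFiltering n r ε).result (Oracle.of f M) π)
  linarith

theorem expectedValue_nonneg (hinst : IsInstance n r f M) :
    0 ≤ (greedyFiltering n r ε).expectedValue (Oracle.of f M) :=
  div_nonneg (Finset.sum_nonneg fun _ _ => hinst.nonneg _) (Nat.cast_nonneg _)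

/-- For δ ≥ 1 the claimed factor is negative. For δ < 1 one has δ ≤ √δ and ε ≤ δ/2, so the loss δ +
7ε/2 is below 8√δ with room to spare. -/
theorem approximation (hinst : IsInstance n r f M) (hε : 0 < ε) (hε' : ε < 1 / 2)
    {Opt : Finset (Fin n)} (hOpt : M.Indep (Opt : Set (Fin n)))
    (hmax : ∀ X : Finset (Fin n), M.Indep (X : Set (Fin n)) → f X ≤ f Opt) :
    (1 / 2 - 8 * √(2 * ε + 2 * (r : ℝ) / (n : ℝ))) * f Opt ≤
      (greedyFiltering n r ε).expectedValue (Oracle.of f M) := by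
  have hOpt0 := hinst.nonneg Opt
  have hrn : 0 ≤ 2 * (r : ℝ) / n := by positivity
  rcases lt_or_ge (2 * ε + 2 * (r : ℝ) / n) 1 with hδ | hδ
  · refine le_trans ?_ (expectedValue_ge hinst hε hε' hδ hOpt hmax)
    refine mul_le_mul_of_nonneg_right ?_ hOpt0
    have h1 : 2 * ε + 2 * (r : ℝ) / n ≤ √(2 * ε + 2 * (r : ℝ) / n) := by
      apply Real.le_sqrt_of_sq_le
      nlinarith
    linarith
  · refine le_trans ?_ (expectedValue_nonneg hinst)
    apply mul_nonpos_of_nonpos_of_nonneg _ hOpt0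
    have : 1 ≤ √(2 * ε + 2 * (r : ℝ) / n) := Real.one_le_sqrt.2 hδ
    linarith

end

end GreedyFiltering

/-! ### The main theorem. -/

theorem mainTheorem2 :
    -- Greedy-Filtering obeys the rules of the streaming model
    (∀ (n r : ℕ) (ε : ℝ), 1 ≤ r → 0 < ε → ε < 1 / 2 → (greedyFiltering n r ε).IsStreaming) ∧
    -- it returns independent sets and achieves a `1/2 - ε'` approximation in random order
    (∀ (n r : ℕ) (f : Finset (Fin n) → ℝ) (M : Matroid (Fin n)) (ε : ℝ),
      IsInstance n r f M → 0 < ε → ε < 1 / 2 →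
      (∀ π : Equiv.Perm (Fin n),
        M.Indep ((greedyFiltering n r ε).result (Oracle.of f M) π : Set (Fin n))) ∧
      ∀ Opt : Finset (Fin n), M.Indep (Opt : Set (Fin n)) →
        (∀ X : Finset (Fin n), M.Indep (X : Set (Fin n)) → f X ≤ f Opt) →
        (1 / 2 - 8 * √(2 * ε + 2 * (r : ℝ) / (n : ℝ))) * f Opt ≤
          (greedyFiltering n r ε).expectedValue (Oracle.of f M)) ∧
    -- it uses `O(r ln(r/ε)² / ε²)` memory, with an absolute constant
    (∃ C : ℝ, 0 < C ∧
      ∀ (n r : ℕ) (f : Finset (Fin n) → ℝ) (M : Matroid (Fin n)) (ε : ℝ),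
        IsInstance n r f M → 0 < ε → ε < 1 / 2 →
        ((greedyFiltering n r ε).memoryUsed (Oracle.of f M) : ℝ) ≤
          C * ((r : ℝ) * Real.log ((r : ℝ) / ε) ^ 2 / ε ^ 2)) ∧
    -- it is semi-streaming: for fixed `ε`, the memory is `r` up to polylogarithmic factors
    (∀ ε : ℝ, 0 < ε → ε < 1 / 2 → ∃ (C : ℝ) (k : ℕ), 0 < C ∧
      ∀ (n r : ℕ) (f : Finset (Fin n) → ℝ) (M : Matroid (Fin n)),
        IsInstance n r f M →
        ((greedyFiltering n r ε).memoryUsed (Oracle.of f M) : ℝ) ≤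
          C * ((r : ℝ) * (1 + Real.log (r : ℝ)) ^ k)) := by
  refine ⟨fun n r ε _ _ _ => greedyFiltering_isStreaming n r ε, ?_, ?_, ?_⟩
  · intro n r f M ε hinst hε hε'
    exact ⟨result_indep, fun Opt hOpt hmax => approximation hinst hε hε' hOpt hmax⟩
  · refine ⟨15, by norm_num, fun n r f M ε hinst hε hε' => ?_⟩
    exact memoryUsed_le n r ε _ (hinst.rank_pos.trans (rank_le_of_isInstance hinst))
      hinst.rank_pos hε hε'
  · intro ε hε hε'
    have hlog : 0 ≤ Real.log (1 / ε) := Real.log_nonneg (by rw [le_div_iff₀ hε]; linarith)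
    -- The dependence on ε is split off through ln(r/ε) = ln r + ln(1/ε) ≤ (1 + ln(1/ε))(1 + ln r),
    -- which leaves the exponent 2.
    refine ⟨15 * ((1 + Real.log (1 / ε)) ^ 2 / ε ^ 2), 2, by positivity,
      fun n r f M hinst => ?_⟩
    refine (memoryUsed_le n r ε _ (hinst.rank_pos.trans (rank_le_of_isInstance hinst))
      hinst.rank_pos hε hε').trans ?_
    have h := log_div_sq_le hinst.rank_pos hε hε'
    calc 15 * ((r : ℝ) * Real.log ((r : ℝ) / ε) ^ 2 / ε ^ 2)
        ≤ 15 * ((r : ℝ) * ((1 + Real.log (1 / ε)) ^ 2 * (1 + Real.log (r : ℝ)) ^ 2) / ε ^ 2) := by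
          gcongr
      _ = _ := by ring
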